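/- Identify $\mathbb R^4$ with the quaternions $\mathbb H$ and $\mathbb R^3$ with $\operatorname{Im}\mathbb H$, and regard $\mathbb H\subset\mathbb{HP}^1=S^4$ via $x\mapsto\binom{x}{1}\mathbb H$. Let $M$ be a simply connected Riemann surface, with $*\omega(X)=\omega(iX)$ for one-forms $\omega$. Let $f\colon M\to\mathbb R^3$ be a smooth conformal immersion with Gauss map $N\colon M\to S^2\subset\operatorname{Im}\mathbb H$, so $*df=N\,df=-df\,N$, and with constant mean curvature $H=1$, i.e. $(dN)':=\tfrac12(dN-N*dN)=-df$. Let $g=f+N$ be its parallel surface. Classical Darboux transforms: let $V=M\times\mathbb H^2$, and for $h\colon M\to\mathbb H$ let $L_h=\binom h1\mathbb H\subset V$, with derivative $\delta_h=\pi d|_{L_h}$, where $\pi\colon V\to V/L_h$. A smooth conformal map (branch points allowed) $f^\sharp\colon M\to\mathbb R^4$ with $f^\sharp(p)\neq f(p)$ for all $p$ is a classical Darboux transform of $f$ if there is a smooth $S\in\Gamma(\operatorname{End}V)$ with $S^2=-1$ such that $SL_h=L_h$ and $*\delta_h=S\delta_h=\delta_hS$ for both $h=f$ and $h=f^\sharp$.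 $\mu$-Darboux transforms: for $\mu\in\mathbb C_*$ put $a=\frac{\mu+\mu^{-1}}2$ and $b=i\,\frac{\mu^{-1}-\mu}2$. Identify $V/L_f$ with the trivial bundle $e\mathbb H$, $e=\binom10$, and define on it the connection $$\nabla^\mu(e\alpha)=e\bigl(d\alpha-\tfrac12(dN)'\,(N\alpha(a-1)+\alpha b)\bigr),\qquad \alpha\colon M\to\mathbb H,$$ with complex numbers acting by right multiplication. A non-trivial $\nabla^\mu$-parallel section $\varphi$ of $V/L_f$ has a lift $\hat\varphi\colon M\to\mathbb H^2$ with $\pi\,d\hat\varphi=0$, and the map $p\mapsto\hat\varphi(p)\mathbb H\in\mathbb{HP}^1$ is called a $\mu$-Darboux transform of $f$. Theorem. Let $f^\sharp=f+T\colon M\to\mathbb R^4$ be a non-constant classical Darboux transform of $f$. 1. $f^\sharp$ is a $\mu$-Darboux transform of $f$ for some $\mu\in\mathbb C_*\setminus\{-1\}$ if and only if there is $r\in\mathbb R\setminus\{0,1\}$ with $$dT=r\,T\,dg\,T-df,\qquad (T-N)^2=r^{-1}-1 .$$ 2. $f^\sharp$ is a $\mu$-Darboux transform of $f$ with $\mu=-1$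 if and only if these two equations hold with $r=1$. 3. If $f^\sharp$ is a $\mu$-Darboux transform of $f$, then $\mu\in(\mathbb R_*\cup S^1)\setminus\{1\}$. If $\mu\in S^1$, then $f^\sharp=g+c$ for a real constant $c$, so $f^\sharp$ is a translate of $g$. If $\mu\in\mathbb R_*$, then $f^\sharp$ takes values in $\mathbb R^3=\operatorname{Im}\mathbb H$ and is a conformal immersion away from isolated branch points, with a smooth Gauss map $N^\sharp$ on all of $M$ ($*df^\sharp=N^\sharp df^\sharp=-df^\sharp N^\sharp$) and constant mean curvature $1$, i.e. $\tfrac12(dN^\sharp-N^\sharp*dN^\sharp)=-df^\sharp$. -/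

import Mathlib

open scoped Manifold ContDiff Quaternion Matrix Topology

noncomputable section

namespace DarbouxCMC

variable {M : Type*} [TopologicalSpace M] [ChartedSpace ℂ M]

/-- Smoothness (over `ℝ`) of a map from a Riemann surface to a real normed space. -/
abbrev Smooth {E : Type*} [NormedAddCommGroup E] [NormedSpace ℝ E] (h : M → E) : Prop :=
  ContMDiff 𝓘(ℝ, ℂ) 𝓘(ℝ, E) ∞ h

/-- The differential `dh_p(X)`. The real tangent space of `M` at `p` is `ℂ`, by means of the
preferred holomorphic chart at `p`, and multiplication by `Complex.I` is the complex structure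
of the Riemann surface. -/
abbrev dif {E : Type*} [NormedAddCommGroup E] [NormedSpace ℝ E] (h : M → E) (p : M) (X : ℂ) : E :=
  mfderiv 𝓘(ℝ, ℂ) 𝓘(ℝ, E) h p X

/-- The conformal structure `*η (X) = η (i X)` on one-forms. -/
def hodge {E : Type*} (η : M → ℂ → E) (p : M) (X : ℂ) : E := η p (Complex.I * X)

/-- A possibly branched conformal map into `ℝ⁴ = ℍ`. -/
structure IsConformalMap (f : M → ℍ[ℝ]) : Prop where
  smooth : Smooth f
  norm_eq : ∀ p X, ‖hodge (dif f) p X‖ = ‖dif f p X‖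
  orthogonal : ∀ p X, inner ℝ (dif f p X) (hodge (dif f) p X) = 0

/-- `N : M → S² ⊂ ℝ³ = Im ℍ` is a Gauss map of the (possibly branched) conformal map
`f : M → ℝ³ = Im ℍ`, that is `*df = N df = - df N`. Where `f` is immersed this says that `f` is
conformal and `N` is its oriented unit normal. -/
structure IsGaussMap (f N : M → ℍ[ℝ]) : Prop where
  smooth_f : Smooth f
  smooth_N : Smooth N
  re_f : ∀ p, (f p).re = 0
  re_N : ∀ p, (N p).re = 0
  sq_N : ∀ p, N p * N p = -1
  left : ∀ p X, hodge (dif f) p X = N p * dif f p X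
  right : ∀ p X, hodge (dif f) p X = -(dif f p X * N p)

/-- The `(1,0)`-part `½ (dN - N *dN)` of `dN` with respect to `N`. -/
def dNPrime (N : M → ℍ[ℝ]) (p : M) (X : ℂ) : ℍ[ℝ] :=
  (1 / 2 : ℝ) • (dif N p X - N p * hodge (dif N) p X)

/-- The surface `f` with Gauss map `N` has constant mean curvature `H`: `(dN)' = - H df`. -/
def HasMeanCurvature (f N : M → ℍ[ℝ]) (H : ℝ) : Prop :=
  ∀ p X, dNPrime N p X = -(H • dif f p X)

/-- `f : M → ℝ³` is a conformal immersion with Gauss map `N` and constant mean curvature `1`. -/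
structure IsCMCSurface (f N : M → ℍ[ℝ]) : Prop where
  gauss : IsGaussMap f N
  immersion : ∀ p, Function.Injective (dif f p)
  meanCurvature : HasMeanCurvature f N 1

/-- `f : M → ℝ³` is a branched conformal immersion (an immersion away from isolated points, with
a Gauss map on all of `M`) of constant mean curvature `1`. -/
def IsBranchedCMCSurface (f : M → ℍ[ℝ]) : Prop :=
  (∃ N : M → ℍ[ℝ], IsGaussMap f N ∧ HasMeanCurvature f N 1) ∧
    ∀ p, ∀ᶠ q in 𝓝[≠] p, Function.Injective (dif f q)

/-- The section `ψ = (f, 1)` of the trivial bundle `V` with fibre the right vector space `ℍ²`. -/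
def psi (f : M → ℍ[ℝ]) (p : M) : Fin 2 → ℍ[ℝ] := ![f p, 1]

/-- The fibre at `p` of the quaternionic line subbundle `L = ψ ℍ ⊂ V` of the map
`f : M → ℍ ⊂ ℍP¹ = S⁴`. Right vector spaces over `ℍ` are modules over the opposite ring. -/
def lineBundle (f : M → ℍ[ℝ]) (p : M) : Submodule ℍ[ℝ]ᵐᵒᵖ (Fin 2 → ℍ[ℝ]) :=
  Submodule.span ℍ[ℝ]ᵐᵒᵖ {psi f p}

/-- A representative in `V` of `δ_p(X) v ∈ V / L`, where `δ = π d|_L` is the derivative of the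
map given by `L`. For `v ∈ L_p` one has `v = ψ(p) v₁`, so `δ_p(X) v` is represented by
`dψ_p(X) v₁`. -/
def deltaRep (f : M → ℍ[ℝ]) (p : M) (X : ℂ) (v : Fin 2 → ℍ[ℝ]) : Fin 2 → ℍ[ℝ] :=
  MulOpposite.op (v 1) • dif (psi f) p X

/-- A sphere congruence: a smooth section `S` of `End V` with `S² = -1`. -/
structure IsSphereCongruence (S : M → Matrix (Fin 2) (Fin 2) ℍ[ℝ]) : Prop where
  smooth : ∀ i j, Smooth (fun p => S p i j)
  sq : ∀ p, S p * S p = -1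

/-- `S` envelopes `f`: `S L = L` and `*δ = S δ = δ S` as maps from `L` to `V / L`. -/
structure Envelopes (S : M → Matrix (Fin 2) (Fin 2) ℍ[ℝ]) (f : M → ℍ[ℝ]) : Prop where
  maps : ∀ p, ∀ v ∈ lineBundle f p, S p *ᵥ v ∈ lineBundle f p
  left : ∀ p X, ∀ v ∈ lineBundle f p,
    (lineBundle f p).mkQ (hodge (deltaRep f) p X v) = (lineBundle f p).mkQ (S p *ᵥ deltaRep f p X v)
  right : ∀ p X, ∀ v ∈ lineBundle f p,
    (lineBundle f p).mkQ (hodge (deltaRep f) p X v) = (lineBundle f p).mkQ (deltaRep f p X (S p *ᵥ v))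

/-- `fs : M → ℝ⁴` is a classical Darboux transform of `f`. -/
structure IsClassicalDarboux (f fs : M → ℍ[ℝ]) : Prop where
  conformal : IsConformalMap fs
  ne : ∀ p, f p ≠ fs p
  enveloped : ∃ S : M → Matrix (Fin 2) (Fin 2) ℍ[ℝ],
    IsSphereCongruence S ∧ Envelopes S f ∧ Envelopes S fs

/-- The complex number `a = (μ + μ⁻¹) / 2`. -/
def aOf (μ : ℂ) : ℂ := (μ + μ⁻¹) / 2

/-- The complex number `b = i (μ⁻¹ - μ) / 2`. -/
def bOf (μ : ℂ) : ℂ := (μ⁻¹ - μ) / 2 * Complex.I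

/-- The form `*A = - ½ (∇J)'`. Here `V / L` is identified with the trivial bundle `e ℍ`,
`e = (1, 0)`, and endomorphisms of `V / L` with left multiplications, so that `J` is `N`, the
trivial connection is `d`, and `(∇J)'` is `(dN)'`. -/
def starA (N : M → ℍ[ℝ]) (p : M) (X : ℂ) : ℍ[ℝ] := -((1 / 2 : ℝ) • dNPrime N p X)

/-- The connection `∇^μ = ∇ + *A (J (a - 1) + b)` applied to the section `e α` of `V / L = e ℍ`.
Complex scalars act by right multiplication. -/
def nablaMu (N : M → ℍ[ℝ]) (μ : ℂ) (α : M → ℍ[ℝ]) (p : M) (X : ℂ) : ℍ[ℝ] :=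
  dif α p X + starA N p X *
    (N p * α p * ((aOf μ - 1 : ℂ) : ℍ[ℝ]) + α p * ((bOf μ : ℂ) : ℍ[ℝ]))

/-- `F` is the prolongation of the section of `V / L` represented by `e α`: a lift to `V` with
`π dF = 0`. -/
structure IsProlongation (f α : M → ℍ[ℝ]) (F : M → Fin 2 → ℍ[ℝ]) : Prop where
  smooth : Smooth F
  lift : ∀ p, (lineBundle f p).mkQ (F p) = (lineBundle f p).mkQ ![α p, 0]
  closed : ∀ p X, (lineBundle f p).mkQ (dif F p X) = 0

/-- On simply connected `M`, the map `fh : M → ℍ ⊂ ℍP¹` is a `μ`-Darboux transform of the surface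
`f` with Gauss map `N`: it is `F ℍ` for the prolongation `F` of a non-trivial
`∇^μ`-parallel section of `V / L`. -/
def IsMuDarboux (f N : M → ℍ[ℝ]) (μ : ℂ) (fh : M → ℍ[ℝ]) : Prop :=
  μ ≠ 0 ∧ ∃ (α : M → ℍ[ℝ]) (F : M → Fin 2 → ℍ[ℝ]),
    Smooth α ∧ (∃ p, α p ≠ 0) ∧ (∀ p X, nablaMu N μ α p X = 0) ∧
    IsProlongation f α F ∧
    ∀ p, Submodule.span ℍ[ℝ]ᵐᵒᵖ {F p} = lineBundle fh p

/-- With `g = f + N` and `T = fs - f`: the equations `dT = r T dg T - df` and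
`(T - N)² = r⁻¹ - 1`. -/
def SatisfiesRiccati (f N fs : M → ℍ[ℝ]) (r : ℝ) : Prop :=
  (∀ p X, dif (fun q => fs q - f q) p X =
    r • ((fs p - f p) * dif (fun q => f q + N q) p X * (fs p - f p)) - dif f p X) ∧
  ∀ p, (fs p - f p - N p) ^ 2 = ((r⁻¹ - 1 : ℝ) : ℍ[ℝ])

end DarbouxCMC

end

/-! Write T = f♯ - f, g = f + N and β = `muDual N μ α`. Since (dN)' = -df, a section α is parallel
for ∇^μ exactly when dα = -df β. Its prolongation is then (α + fβ, β), and this spans the line of f♯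
exactly when α = Tβ (`isMuDarboux_iff`). The relation a² + b² = 1 gives dβ = ½ dg α(a-1), hence df♯
= -½ T dg (α(a-1)α⁻¹) T (`IsMuSection.dif_eq_sub`).

A common sphere congruence gives *df♯ = df♯ T⁻¹NT (`IsClassicalDarboux.right_normal`). As *dg = dg
N, the normal N must commute with α(a-1)α⁻¹ wherever dg ≠ 0. If a were not real, α⁻¹Nα would be
locally constant, equal to i or -i, and differentiating Nα = ±αi would give dg = 0, which is
impossible for non-constant f♯ (`IsMuSection.aOf_im_eq_zero`). So a = 1 - 2r with r real, which
means that μ is real or unimodular; r ≠ 0 because f♯ is not constant. The formula for df♯ becomes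
the Riccati equation, and T⁻¹ + rN = ½ αbα⁻¹ has square b²/4 = r(1-r), which is the quadratic
equation in disguise (`sq_sub_eq_iff`).

Conversely, a solution of the two equations makes the system dα = -df T⁻¹α integrable. It has a
global solution on the simply connected M, and α⁻¹(T⁻¹ + rN)α is constant with square r(1-r). A
suitable initial value turns this constant into a complex number, which is b/2 for some μ with a = 1
- 2r (`SatisfiesRiccati.exists_isMuSection`). The case r = 1 is a = -1, that is μ = -1.

For |μ| = 1 the number b is real and T⁻¹ = -rN + b/2 inverts to T = N + b/(2r). For real μ the
number b is imaginary, so T is imaginary, T² is real, and N♯ = -TNT⁻¹ is a Gauss map of f♯ with mean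
curvature 1. Branch points of f♯ are zeros of dg, hence of the holomorphic Hopf coefficient of f,
hence isolated. -/

noncomputable section

namespace DarbouxCMC

/-! ### Local solutions of flat linear total differential equations. -/

section LocalFrame

open Set Metric

variable {A : Type*} [NormedRing A] [NormedAlgebra ℝ A] [CompleteSpace A]

/-- The smallness of Ω is there for the last estimate: it keeps the end value of the solution away
from 0. -/
theorem exists_linear_ode_solution [NormOneClass A] {Ω : ℝ → A}
    (hΩ : ContinuousOn Ω (Icc 0 1)) (hb : ∀ t ∈ Icc (0 : ℝ) 1, ‖Ω t‖ ≤ 1 / 4) :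
    ∃ y : ℝ → A, y 0 = 1 ∧
      (∀ t ∈ Icc (0 : ℝ) 1, HasDerivWithinAt y (Ω t * y t) (Icc 0 1) t) ∧ ‖y 1 - 1‖ < 1 := by
  -- On the unit ball around 1 one has ‖y‖ ≤ 2, so the field has norm at most 1/2 and the solution
  -- stays in that ball up to time 1.
  have hPL : IsPicardLindelof (fun t (y : A) => Ω t * y)
      (⟨0, left_mem_Icc.2 zero_le_one⟩ : Icc (0 : ℝ) 1) 1 1 0 1 1 := by
    refine ⟨fun t ht => ?_, fun x _ => hΩ.mul continuousOn_const, fun t ht x hx => ?_, by simp⟩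
    · refine LipschitzOnWith.of_dist_le_mul fun x _ y _ => ?_
      rw [dist_eq_norm, dist_eq_norm, ← mul_sub]
      refine (norm_mul_le _ _).trans ?_
      gcongr
      exact (hb t ht).trans (by norm_num)
    · have h1 : ‖x‖ ≤ 2 := by
        have := norm_add_le (x - 1) (1 : A)
        rw [mem_closedBall, dist_eq_norm] at hx
        simp only [sub_add_cancel, norm_one, NNReal.coe_one] at this hx
        linarith
      refine (norm_mul_le _ _).trans ?_
      calc ‖Ω t‖ * ‖x‖ ≤ 1 / 4 * 2 := by gcongr; exact hb t ht
        _ ≤ _ := by norm_num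
  obtain ⟨y, hy0, hy⟩ := hPL.exists_eq_forall_mem_Icc_hasDerivWithinAt₀
  refine ⟨y, hy0, hy, ?_⟩
  have hcont : ContinuousOn y (Icc 0 1) := fun t ht => (hy t ht).continuousWithinAt
  have hbd : ∀ t ∈ Icc (0 : ℝ) 1, ‖y t‖ ≤ 3 := by
    intro t ht
    have := norm_le_gronwallBound_of_norm_deriv_right_le (δ := 1) (K := 1 / 4) (ε := 0) hcont
      (fun x hx => (hy x (Ico_subset_Icc_self hx)).mono_of_mem_nhdsWithin
        (Icc_mem_nhdsGE_of_mem hx)) (by rw [hy0]; simp)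
      (fun x hx => by
        refine (norm_mul_le _ _).trans ?_
        rw [add_zero]
        gcongr
        exact hb x (Ico_subset_Icc_self hx)) t ht
    rw [gronwallBound_ε0] at this
    have h1 : Real.exp (1 / 4 * (t - 0)) ≤ Real.exp 1 := by
      apply Real.exp_le_exp.2; linarith [ht.2]
    have h2 := Real.exp_one_lt_d9
    linarith
  have := norm_image_sub_le_of_norm_deriv_le_segment_01' (C := 3 / 4) hy (fun t ht => by
    refine (norm_mul_le _ _).trans ?_
    calc ‖Ω t‖ * ‖y t‖ ≤ 1 / 4 * 3 := by
          gcongr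
          exacts [hb t (Ico_subset_Icc_self ht), hbd t (Ico_subset_Icc_self ht)]
      _ = _ := by norm_num)
  rw [hy0] at this
  linarith

variable {E : Type*} [NormedAddCommGroup E] [NormedSpace ℝ E]

/-- Collects, on one ball, the constants of the Gronwall argument below: `C * R ≤ 1 / 4` feeds the
radial equation, and the Lipschitz constant `K` of the derivative controls second-order Taylor
remainders. -/
theorem exists_ball_bounds {F : Type*} [NormedAddCommGroup F] [NormedSpace ℝ F] {η : E → F}
    {s : Set E} (hs : IsOpen s) (hη : ContDiffOn ℝ 2 η s) {z₀ : E} (hz₀ : z₀ ∈ s) :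
    ∃ R C K : ℝ, 0 < R ∧ R ≤ 1 ∧ 0 ≤ C ∧ 0 ≤ K ∧ C * R ≤ 1 / 4 ∧ ball z₀ R ⊆ s ∧
      (∀ z ∈ ball z₀ R, DifferentiableAt ℝ η z ∧ ‖η z‖ ≤ C ∧ ‖fderiv ℝ η z‖ ≤ C) ∧
      ∀ z ∈ ball z₀ R, ∀ w ∈ ball z₀ R, ‖fderiv ℝ η z - fderiv ℝ η w‖ ≤ K * ‖z - w‖ := by
  have hat : ContDiffAt ℝ 2 η z₀ := hη.contDiffAt (hs.mem_nhds hz₀)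
  have hd : ContDiffAt ℝ 1 (fderiv ℝ η) z₀ := hat.fderiv_right (by norm_num)
  obtain ⟨K, t, ht, hK⟩ := hd.exists_lipschitzOnWith
  set C : ℝ := max ‖η z₀‖ ‖fderiv ℝ η z₀‖ + 1 with hC
  have hC0 : 0 < C := by positivity
  have h1 : ∀ᶠ z in 𝓝 z₀, ‖η z‖ < C :=
    hat.continuousAt.norm.eventually_lt_const (by
      rw [hC]; linarith [le_max_left ‖η z₀‖ ‖fderiv ℝ η z₀‖])
  have h2 : ∀ᶠ z in 𝓝 z₀, ‖fderiv ℝ η z‖ < C :=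
    hd.continuousAt.norm.eventually_lt_const (by
      rw [hC]; linarith [le_max_right ‖η z₀‖ ‖fderiv ℝ η z₀‖])
  obtain ⟨r, hr, hball⟩ := Metric.eventually_nhds_iff_ball.1
    ((h1.and h2).and ((hs.eventually_mem hz₀).and ht))
  refine ⟨min r (min 1 (1 / (4 * C))), C, K, by positivity, ?_, hC0.le, K.2, ?_, ?_, ?_, ?_⟩
  · exact (min_le_right _ _).trans (min_le_left _ _)
  · calc C * min r (min 1 (1 / (4 * C))) ≤ C * (1 / (4 * C)) := by
          gcongr; exact (min_le_right _ _).trans (min_le_right _ _)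
      _ = 1 / 4 := by field_simp
  · exact fun z hz => (hball z (ball_subset_ball (min_le_left _ _) hz)).2.1
  · intro z hz
    have := hball z (ball_subset_ball (min_le_left _ _) hz)
    exact ⟨(hη.differentiableOn (by norm_num)).differentiableAt (hs.mem_nhds this.2.1),
      this.1.1.le, this.1.2.le⟩
  · intro z hz w hw
    have h := hK.dist_le_mul z (hball z (ball_subset_ball (min_le_left _ _) hz)).2.2 w
      (hball w (ball_subset_ball (min_le_left _ _) hw)).2.2
    rwa [dist_eq_norm, dist_eq_norm] at h

/-- Local existence of parallel frames: the system `dα = η α` with `dη = η ∧ η` has, near each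
point, a solution that takes values in units. -/
theorem exists_local_frame [NormOneClass A] {η : E → E →L[ℝ] A} {s : Set E} (hs : IsOpen s)
    (hη : ContDiffOn ℝ 2 η s)
    (flat : ∀ z ∈ s, ∀ X Y, fderiv ℝ η z X Y - fderiv ℝ η z Y X =
      η z X * η z Y - η z Y * η z X) {z₀ : E} (hz₀ : z₀ ∈ s) :
    ∃ R > 0, ball z₀ R ⊆ s ∧ ∃ α : E → A, (∀ z ∈ ball z₀ R, ‖α z - 1‖ < 1) ∧
      ∀ z ∈ ball z₀ R,
        HasFDerivAt α (((ContinuousLinearMap.mul ℝ A).flip (α z)).comp (η z)) z := by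
  obtain ⟨R, C, K, hR, hR1, hC, hK, hCR, hRs, hb, hL⟩ := exists_ball_bounds hs hη hz₀
  refine ⟨R, hR, hRs, ?_⟩
  have hseg : ∀ z ∈ ball z₀ R, ∀ t ∈ Icc (0 : ℝ) 1, z₀ + t • (z - z₀) ∈ ball z₀ R := by
    intro z hz t ht
    have hz' := mem_ball_iff_norm.1 hz
    rw [mem_ball_iff_norm]
    rw [add_sub_cancel_left, norm_smul, Real.norm_of_nonneg ht.1]
    nlinarith [ht.2, norm_nonneg (z - z₀)]
  have hγ : ∀ z : E, ∀ t : ℝ, HasDerivAt (fun t : ℝ => z₀ + t • (z - z₀)) (z - z₀) t := by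
    intro z t
    simpa using ((hasDerivAt_id t).smul_const (z - z₀)).const_add z₀
  have hηγ : ∀ z ∈ ball z₀ R, ∀ t ∈ Icc (0 : ℝ) 1,
      HasDerivAt (fun t : ℝ => η (z₀ + t • (z - z₀)))
        (fderiv ℝ η (z₀ + t • (z - z₀)) (z - z₀)) t := fun z hz t ht =>
    (hb _ (hseg z hz t ht)).1.hasFDerivAt.comp_hasDerivAt t (hγ z t)
  -- The candidate is defined by solving the equation along the rays from z₀; flatness must then
  -- give the derivative in all directions.
  have hode : ∀ z ∈ ball z₀ R, ∃ y : ℝ → A, y 0 = 1 ∧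
      (∀ t ∈ Icc (0 : ℝ) 1, HasDerivWithinAt y
        (η (z₀ + t • (z - z₀)) (z - z₀) * y t) (Icc 0 1) t) ∧ ‖y 1 - 1‖ < 1 := by
    intro z hz
    apply exists_linear_ode_solution
    · exact fun t ht =>
        ((hηγ z hz t ht).continuousAt.clm_apply continuousAt_const).continuousWithinAt
    · intro t ht
      refine (ContinuousLinearMap.le_opNorm _ _).trans (le_trans ?_ hCR)
      gcongr
      exacts [(hb _ (hseg z hz t ht)).2.1, (mem_ball_iff_norm.1 hz).le]
  choose! y hy0 hy hy1 using hode
  refine ⟨fun z => y z 1, hy1, fun z hz => ?_⟩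
  obtain ⟨B, hB⟩ := isCompact_Icc.exists_bound_of_continuousOn (s := Icc (0 : ℝ) 1) (f := y z)
    (fun t ht => (hy z hz t ht).continuousWithinAt)
  have hB0 : 0 ≤ B := (norm_nonneg _).trans (hB 0 (by simp))
  -- With h = z' - z, the error u(t) = y_{z'}(t) - y_z(t) - t η(h) y_z(t) vanishes at t = 0 and
  -- solves a linear equation up to O(‖h‖²). Gronwall gives u(1) = O(‖h‖²), which is
  -- differentiability at z with derivative ηα.
  have key : ∀ z' ∈ ball z₀ R, ‖y z' 1 - y z 1 - η z (z' - z) * y z 1‖ ≤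
      gronwallBound 0 1 ((K + C + 2 * C ^ 2) * B) 1 * ‖z' - z‖ ^ 2 := by
    intro z' hz'
    set h := z' - z with hh
    set a : ℝ → E →L[ℝ] A := fun t => η (z₀ + t • (z - z₀)) with ha
    set a' : ℝ → E →L[ℝ] A := fun t => η (z₀ + t • (z' - z₀)) with ha'
    have hu : ∀ t ∈ Icc (0 : ℝ) 1, HasDerivWithinAt
        (fun t => y z' t - y z t - t • (a t h * y z t))
        (a' t (z' - z₀) * y z' t - a t (z - z₀) * y z t -
          (t • (fderiv ℝ η (z₀ + t • (z - z₀)) (z - z₀) h * y z t +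
            a t h * (a t (z - z₀) * y z t)) + (1 : ℝ) • (a t h * y z t))) (Icc 0 1) t := by
      intro t ht
      have h3 : HasDerivWithinAt (fun t => a t h)
          (fderiv ℝ η (z₀ + t • (z - z₀)) (z - z₀) h) (Icc 0 1) t := by
        have := (hηγ z hz t ht).clm_apply (hasDerivAt_const t h)
        simpa using this.hasDerivWithinAt
      exact ((hy z' hz' t ht).sub (hy z hz t ht)).sub
        ((hasDerivWithinAt_id t _).smul (h3.mul (hy z hz t ht)))
    have hbound : ∀ t ∈ Ico (0 : ℝ) 1,
        ‖a' t (z' - z₀) * y z' t - a t (z - z₀) * y z t -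
          (t • (fderiv ℝ η (z₀ + t • (z - z₀)) (z - z₀) h * y z t +
            a t h * (a t (z - z₀) * y z t)) + (1 : ℝ) • (a t h * y z t))‖ ≤
        1 * ‖y z' t - y z t - t • (a t h * y z t)‖ +
          (K + C + 2 * C ^ 2) * B * ‖h‖ ^ 2 := by
      intro t ht'
      have ht : t ∈ Icc (0 : ℝ) 1 := Ico_subset_Icc_self ht'
      have hm := hseg z hz t ht
      have hm' := hseg z' hz' t ht
      set D := fderiv ℝ η (z₀ + t • (z - z₀)) with hD
      have hfl := flat _ (hRs hm) (z - z₀) h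
      have hdiff : (z₀ + t • (z' - z₀)) - (z₀ + t • (z - z₀)) = t • h := by
        rw [hh]; module
      have hzh : z' - z₀ = (z - z₀) + h := by rw [hh]; abel
      have hw' : ‖z' - z₀‖ ≤ 1 := (mem_ball_iff_norm.1 hz').le.trans hR1
      -- Taylor estimates
      have e1 : ‖a' t - a t‖ ≤ C * ‖h‖ := by
        have := (convex_ball z₀ R).norm_image_sub_le_of_norm_hasFDerivWithin_le (C := C)
          (fun x hx => (hb x hx).1.hasFDerivAt.hasFDerivWithinAt) (fun x hx => (hb x hx).2.2)
          hm hm'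
        rw [hdiff, norm_smul, Real.norm_of_nonneg ht.1] at this
        refine this.trans ?_
        gcongr
        nlinarith [ht.2, norm_nonneg h]
      have e2 : ‖a' t - a t - t • D h‖ ≤ K * ‖h‖ ^ 2 := by
        have hss : segment ℝ (z₀ + t • (z - z₀)) (z₀ + t • (z' - z₀)) ⊆ ball z₀ R :=
          (convex_ball z₀ R).segment_subset hm hm'
        have := (convex_segment (𝕜 := ℝ) (z₀ + t • (z - z₀))
          (z₀ + t • (z' - z₀))).norm_image_sub_le_of_norm_hasFDerivWithin_le' (C := K * ‖h‖)
          (φ := D) (fun x hx => (hb x (hss hx)).1.hasFDerivAt.hasFDerivWithinAt)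
          (fun x hx => by
            refine (hL x (hss hx) _ hm).trans ?_
            gcongr
            refine (norm_sub_le_of_mem_segment hx).trans ?_
            rw [hdiff, norm_smul, Real.norm_of_nonneg ht.1]
            nlinarith [ht.2, norm_nonneg h])
          (left_mem_segment ℝ _ _) (right_mem_segment ℝ _ _)
        rw [hdiff, map_smul, norm_smul, Real.norm_of_nonneg ht.1] at this
        refine this.trans ?_
        have := ht.2
        have h0 := norm_nonneg h
        calc K * ‖h‖ * (t * ‖h‖) ≤ K * ‖h‖ * (1 * ‖h‖) := by gcongr
          _ = _ := by ring
      have hah : ‖a t h‖ ≤ C * ‖h‖ :=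
        ((a t).le_opNorm h).trans (by gcongr; exact (hb _ hm).2.1)
      have f1 : ‖(a' t - a t - t • D h) (z' - z₀)‖ ≤ K * ‖h‖ ^ 2 :=
        (ContinuousLinearMap.le_opNorm _ _).trans (by
          calc _ ≤ K * ‖h‖ ^ 2 * 1 := by gcongr
            _ = _ := mul_one _)
      have f2 : ‖t • D h h‖ ≤ C * ‖h‖ ^ 2 := by
        rw [norm_smul, Real.norm_of_nonneg ht.1]
        have h1 : ‖D h h‖ ≤ C * ‖h‖ * ‖h‖ := by
          refine (ContinuousLinearMap.le_opNorm _ _).trans ?_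
          gcongr
          refine (ContinuousLinearMap.le_opNorm _ _).trans ?_
          gcongr
          exact (hb _ hm).2.2
        calc t * ‖D h h‖ ≤ 1 * (C * ‖h‖ * ‖h‖) := by gcongr; exact ht.2
          _ = _ := by ring
      have f3 : ‖a' t (z' - z₀) - a t (z - z₀)‖ ≤ 2 * C * ‖h‖ := by
        have : a' t (z' - z₀) - a t (z - z₀) = (a' t - a t) (z' - z₀) + a t h := by
          rw [hzh]; simp only [map_add, sub_apply]; abel
        rw [this]
        refine (norm_add_le _ _).trans ?_
        have := ContinuousLinearMap.le_opNorm (a' t - a t) (z' - z₀)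
        have h4 : ‖(a' t - a t) (z' - z₀)‖ ≤ C * ‖h‖ * 1 := this.trans (by gcongr)
        linarith
      have f4 : ‖a' t (z' - z₀)‖ ≤ 1 := by
        refine (ContinuousLinearMap.le_opNorm _ _).trans ?_
        have : ‖a' t‖ * ‖z' - z₀‖ ≤ C * R := by
          gcongr
          exacts [(hb _ hm').2.1, (mem_ball_iff_norm.1 hz').le]
        linarith
      -- Flatness exchanges D(z - z₀)h for D(h)(z - z₀) plus a commutator. This cancels every
      -- first-order term except the one proportional to u.
      have hid : a' t (z' - z₀) * y z' t - a t (z - z₀) * y z t -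
          (t • (D (z - z₀) h * y z t + a t h * (a t (z - z₀) * y z t)) +
            (1 : ℝ) • (a t h * y z t)) =
          a' t (z' - z₀) * (y z' t - y z t - t • (a t h * y z t)) +
          (((a' t - a t - t • D h) (z' - z₀) + t • D h h) * y z t +
            t • ((a' t (z' - z₀) - a t (z - z₀)) * a t h * y z t)) := by
        have hfl' : D (z - z₀) h = D h (z - z₀) + (a t (z - z₀) * a t h - a t h * a t (z - z₀)) := by
          rw [← hfl]; abel
        rw [hfl', hzh]
        simp only [map_add, sub_apply, smul_apply,
          smul_add, smul_sub, add_mul, sub_mul, mul_sub, smul_mul_assoc, mul_smul_comm,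
          mul_assoc, one_smul]
        module
      rw [hid]
      refine (norm_add_le _ _).trans (add_le_add ?_ ((norm_add_le _ _).trans ?_))
      · exact (norm_mul_le _ _).trans (by gcongr)
      · have g1 : ‖((a' t - a t - t • D h) (z' - z₀) + t • D h h) * y z t‖ ≤
            (K * ‖h‖ ^ 2 + C * ‖h‖ ^ 2) * B := by
          refine (norm_mul_le _ _).trans ?_
          gcongr
          exacts [(norm_add_le _ _).trans (add_le_add f1 f2), hB t ht]
        have g2 : ‖t • ((a' t (z' - z₀) - a t (z - z₀)) * a t h * y z t)‖ ≤
            1 * (2 * C * ‖h‖ * (C * ‖h‖) * B) := by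
          rw [norm_smul, Real.norm_of_nonneg ht.1]
          have := ht.2
          gcongr
          refine (norm_mul_le _ _).trans ?_
          gcongr
          · exact (norm_mul_le _ _).trans (by gcongr)
          · exact hB t ht
        linarith
    have := norm_le_gronwallBound_of_norm_deriv_right_le (δ := 0)
      (fun t ht => (hu t ht).continuousWithinAt)
      (fun t ht => (hu t (Ico_subset_Icc_self ht)).mono_of_mem_nhdsWithin
        (Icc_mem_nhdsGE_of_mem ht)) (by simp [hy0 z hz, hy0 z' hz']) hbound 1 (by simp)
    rw [gronwallBound_of_K_ne_0 one_ne_zero] at this ⊢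
    simp only [one_smul, ha, add_sub_cancel] at this
    refine this.trans (le_of_eq ?_)
    ring_nf
  rw [hasFDerivAt_iff_isLittleO]
  refine Asymptotics.IsBigO.trans_isLittleO (g := fun z' => ‖z' - z‖ ^ 2) ?_ ?_
  · refine Asymptotics.IsBigO.of_bound (gronwallBound 0 1 ((K + C + 2 * C ^ 2) * B) 1) ?_
    filter_upwards [isOpen_ball.mem_nhds hz] with z' hz'
    simpa [← sub_mul] using key z' hz'
  · exact Asymptotics.isLittleO_pow_sub_sub z one_lt_two

end LocalFrame

/-! ### Calculus of differentials in holomorphic charts. -/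

section Charts

variable {M : Type*} [TopologicalSpace M] [ChartedSpace ℂ M]
  {E : Type*} [NormedAddCommGroup E] [NormedSpace ℝ E]

theorem mdifferentiableAt_iff_chart {h : M → E} {p : M} :
    MDifferentiableAt 𝓘(ℝ, ℂ) 𝓘(ℝ, E) h p ↔
      ContinuousAt h p ∧ DifferentiableAt ℝ (h ∘ (chartAt ℂ p).symm) (chartAt ℂ p p) := by
  rw [mdifferentiableAt_iff]
  simp [writtenInExtChartAt, extChartAt, Function.comp_def, chartAt_self_eq,
    differentiableWithinAt_univ]

theorem dif_eq_fderiv_chartAt {h : M → E} {p : M}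
    (hh : MDifferentiableAt 𝓘(ℝ, ℂ) 𝓘(ℝ, E) h p) (X : ℂ) :
    dif h p X = fderiv ℝ (h ∘ (chartAt ℂ p).symm) (chartAt ℂ p p) X := by
  have h1 : (mfderiv 𝓘(ℝ, ℂ) 𝓘(ℝ, E) h p : ℂ →L[ℝ] E) =
      fderiv ℝ (h ∘ (chartAt ℂ p).symm) (chartAt ℂ p p) := by
    refine hh.mfderiv.trans ?_
    simp [writtenInExtChartAt, extChartAt, Function.comp_def, chartAt_self_eq]
    rfl
  exact congrArg (fun f : ℂ →L[ℝ] E => f X) h1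

theorem contMDiffAt_iff_chart {h : M → E} {p : M} {n : WithTop ℕ∞} :
    ContMDiffAt 𝓘(ℝ, ℂ) 𝓘(ℝ, E) n h p ↔
      ContinuousAt h p ∧ ContDiffAt ℝ n (h ∘ (chartAt ℂ p).symm) (chartAt ℂ p p) := by
  rw [contMDiffAt_iff]
  simp [extChartAt, Function.comp_def, chartAt_self_eq, contDiffWithinAt_univ]

theorem Smooth.mdifferentiableAt {h : M → E} (hh : Smooth h) (p : M) :
    MDifferentiableAt 𝓘(ℝ, ℂ) 𝓘(ℝ, E) h p :=
  (ContMDiff.mdifferentiable hh (by simp)) p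

theorem smooth_const (c : E) : Smooth (fun _ : M => c) := contMDiff_const

theorem Smooth.add {h k : M → E} (hh : Smooth h) (hk : Smooth k) :
    Smooth (fun p => h p + k p) :=
  (contDiff_fst.add contDiff_snd : ContDiff ℝ ∞ fun x : E × E => x.1 + x.2).comp_contMDiff
    (hh.prodMk_space hk)

theorem Smooth.sub {h k : M → E} (hh : Smooth h) (hk : Smooth k) :
    Smooth (fun p => h p - k p) :=
  (contDiff_fst.sub contDiff_snd : ContDiff ℝ ∞ fun x : E × E => x.1 - x.2).comp_contMDiff
    (hh.prodMk_space hk)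

theorem Smooth.neg {h : M → E} (hh : Smooth h) : Smooth (fun p => -h p) :=
  (contDiff_neg : ContDiff ℝ ∞ fun x : E => -x).comp_contMDiff hh

theorem Smooth.const_smul {h : M → E} (hh : Smooth h) (c : ℝ) : Smooth (fun p => c • h p) :=
  (contDiff_const_smul c : ContDiff ℝ ∞ fun x : E => c • x).comp_contMDiff hh

theorem Smooth.mul {A : Type*} [NormedRing A] [NormedAlgebra ℝ A] {h k : M → A}
    (hh : Smooth h) (hk : Smooth k) : Smooth (fun p => h p * k p) :=
  (contDiff_fst.mul contDiff_snd : ContDiff ℝ ∞ fun x : A × A => x.1 * x.2).comp_contMDiff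
    (hh.prodMk_space hk)

theorem contDiffAt_quaternion_inv {x : ℍ[ℝ]} (hx : x ≠ 0) {n : WithTop ℕ∞} :
    ContDiffAt ℝ n (fun x : ℍ[ℝ] => x⁻¹) x := by
  have := contDiffAt_ringInverse ℝ (n := n) (Units.mk0 x hx)
  rwa [Ring.inverse_eq_inv'] at this

theorem Smooth.inv {h : M → ℍ[ℝ]} (hh : Smooth h) (h0 : ∀ p, h p ≠ 0) :
    Smooth (fun p => (h p)⁻¹) := fun p =>
  (contDiffAt_quaternion_inv (h0 p)).comp_contMDiffAt (hh p)

theorem dif_add {h k : M → E} {p : M} (hh : MDifferentiableAt 𝓘(ℝ, ℂ) 𝓘(ℝ, E) h p)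
    (hk : MDifferentiableAt 𝓘(ℝ, ℂ) 𝓘(ℝ, E) k p) (X : ℂ) :
    dif (fun q => h q + k q) p X = dif h p X + dif k p X := by
  have h1 := mdifferentiableAt_iff_chart.1 hh
  have h2 := mdifferentiableAt_iff_chart.1 hk
  have h3 : MDifferentiableAt 𝓘(ℝ, ℂ) 𝓘(ℝ, E) (fun q => h q + k q) p :=
    mdifferentiableAt_iff_chart.2 ⟨h1.1.add h2.1, h1.2.add h2.2⟩
  rw [dif_eq_fderiv_chartAt hh, dif_eq_fderiv_chartAt hk, dif_eq_fderiv_chartAt h3]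
  have := h1.2.hasFDerivAt.add h2.2.hasFDerivAt
  exact congrArg (fun f : ℂ →L[ℝ] E => f X) this.fderiv

theorem dif_sub {h k : M → E} {p : M} (hh : MDifferentiableAt 𝓘(ℝ, ℂ) 𝓘(ℝ, E) h p)
    (hk : MDifferentiableAt 𝓘(ℝ, ℂ) 𝓘(ℝ, E) k p) (X : ℂ) :
    dif (fun q => h q - k q) p X = dif h p X - dif k p X := by
  have h1 := mdifferentiableAt_iff_chart.1 hh
  have h2 := mdifferentiableAt_iff_chart.1 hk
  have h3 : MDifferentiableAt 𝓘(ℝ, ℂ) 𝓘(ℝ, E) (fun q => h q - k q) p :=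
    mdifferentiableAt_iff_chart.2 ⟨h1.1.sub h2.1, h1.2.sub h2.2⟩
  rw [dif_eq_fderiv_chartAt hh, dif_eq_fderiv_chartAt hk, dif_eq_fderiv_chartAt h3]
  have := h1.2.hasFDerivAt.sub h2.2.hasFDerivAt
  exact congrArg (fun f : ℂ →L[ℝ] E => f X) this.fderiv

theorem dif_mul {A : Type*} [NormedRing A] [NormedAlgebra ℝ A] {h k : M → A} {p : M}
    (hh : MDifferentiableAt 𝓘(ℝ, ℂ) 𝓘(ℝ, A) h p)
    (hk : MDifferentiableAt 𝓘(ℝ, ℂ) 𝓘(ℝ, A) k p) (X : ℂ) :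
    dif (fun q => h q * k q) p X = dif h p X * k p + h p * dif k p X := by
  have h1 := mdifferentiableAt_iff_chart.1 hh
  have h2 := mdifferentiableAt_iff_chart.1 hk
  have h3 : MDifferentiableAt 𝓘(ℝ, ℂ) 𝓘(ℝ, A) (fun q => h q * k q) p :=
    mdifferentiableAt_iff_chart.2 ⟨h1.1.mul h2.1, h1.2.mul h2.2⟩
  rw [dif_eq_fderiv_chartAt hh, dif_eq_fderiv_chartAt hk, dif_eq_fderiv_chartAt h3]
  have := h1.2.hasFDerivAt.mul' h2.2.hasFDerivAt
  refine (congrArg (fun f : ℂ →L[ℝ] A => f X) this.fderiv).trans ?_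
  simp [add_comm]

theorem dif_const (c : E) (p : M) (X : ℂ) : dif (fun _ : M => c) p X = 0 := by
  rw [dif_eq_fderiv_chartAt (mdifferentiableAt_const)]
  simp [Function.comp_def]

theorem dif_smul_const {h : M → E} {p : M} (hh : MDifferentiableAt 𝓘(ℝ, ℂ) 𝓘(ℝ, E) h p)
    (c : ℝ) (X : ℂ) : dif (fun q => c • h q) p X = c • dif h p X := by
  have h1 := mdifferentiableAt_iff_chart.1 hh
  have h3 : MDifferentiableAt 𝓘(ℝ, ℂ) 𝓘(ℝ, E) (fun q => c • h q) p :=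
    mdifferentiableAt_iff_chart.2 ⟨h1.1.const_smul c, h1.2.const_smul c⟩
  rw [dif_eq_fderiv_chartAt hh, dif_eq_fderiv_chartAt h3]
  have := h1.2.hasFDerivAt.const_smul c
  exact congrArg (fun f : ℂ →L[ℝ] E => f X) this.fderiv

theorem dif_congr {h k : M → E} {p : M} (hhk : h =ᶠ[𝓝 p] k) (X : ℂ) :
    dif h p X = dif k p X := by
  simp only [dif]
  rw [hhk.mfderiv_eq]
  rfl

theorem mdifferentiableAt_mul {A : Type*} [NormedRing A] [NormedAlgebra ℝ A] {h k : M → A} {p : M}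
    (hh : MDifferentiableAt 𝓘(ℝ, ℂ) 𝓘(ℝ, A) h p)
    (hk : MDifferentiableAt 𝓘(ℝ, ℂ) 𝓘(ℝ, A) k p) :
    MDifferentiableAt 𝓘(ℝ, ℂ) 𝓘(ℝ, A) (fun q => h q * k q) p :=
  have h1 := mdifferentiableAt_iff_chart.1 hh
  have h2 := mdifferentiableAt_iff_chart.1 hk
  mdifferentiableAt_iff_chart.2 ⟨h1.1.mul h2.1, h1.2.mul h2.2⟩

theorem mdifferentiableAt_inv {h : M → ℍ[ℝ]} {p : M}
    (hh : MDifferentiableAt 𝓘(ℝ, ℂ) 𝓘(ℝ, ℍ[ℝ]) h p) (h0 : h p ≠ 0) :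
    MDifferentiableAt 𝓘(ℝ, ℂ) 𝓘(ℝ, ℍ[ℝ]) (fun q => (h q)⁻¹) p := by
  have h1 := mdifferentiableAt_iff_chart.1 hh
  refine mdifferentiableAt_iff_chart.2 ⟨h1.1.inv₀ h0, ?_⟩
  have h2 : (h ∘ (chartAt ℂ p).symm) (chartAt ℂ p p) ≠ 0 := by simpa using h0
  exact ((contDiffAt_quaternion_inv h2 (n := 1)).differentiableAt (by simp)).comp _ h1.2

theorem dif_inv {h : M → ℍ[ℝ]} {p : M} (hh : MDifferentiableAt 𝓘(ℝ, ℂ) 𝓘(ℝ, ℍ[ℝ]) h p)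
    (h0 : h p ≠ 0) (X : ℂ) :
    dif (fun q => (h q)⁻¹) p X = -((h p)⁻¹ * dif h p X * (h p)⁻¹) := by
  have h1 := dif_mul hh (mdifferentiableAt_inv hh h0) X
  have h2 : (fun q => h q * (h q)⁻¹) =ᶠ[𝓝 p] fun _ => (1 : ℍ[ℝ]) := by
    filter_upwards [hh.continuousAt.eventually_ne h0] with q hq using mul_inv_cancel₀ hq
  rw [dif_congr h2, dif_const] at h1
  have h3 : h p * dif (fun q => (h q)⁻¹) p X = -(dif h p X * (h p)⁻¹) :=
    (neg_eq_of_add_eq_zero_right h1.symm).symm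
  calc _ = (h p)⁻¹ * (h p * dif (fun q => (h q)⁻¹) p X) := by
        rw [inv_mul_cancel_left₀ h0]
    _ = _ := by rw [h3, mul_neg, mul_assoc]

theorem comp_chart_transition_eventuallyEq {F : Type*} {h : M → F} {p q : M}
    (hq : q ∈ (chartAt ℂ p).source) :
    h ∘ (chartAt ℂ q).symm =ᶠ[𝓝 (chartAt ℂ q q)]
      (h ∘ (chartAt ℂ p).symm) ∘ (chartAt ℂ p ∘ (chartAt ℂ q).symm) := by
  have hm : chartAt ℂ q q ∈ ((chartAt ℂ q).symm ≫ₕ chartAt ℂ p).source := by simp [hq]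
  filter_upwards [((chartAt ℂ q).symm ≫ₕ chartAt ℂ p).open_source.mem_nhds hm] with z hz
  simp only [OpenPartialHomeomorph.trans_source, OpenPartialHomeomorph.symm_source,
    Set.mem_inter_iff, Set.mem_preimage] at hz
  simp [(chartAt ℂ p).left_inv hz.2]

theorem continuousAt_of_chart {F : Type*} [TopologicalSpace F] {h : M → F} {p q : M} (hq : q ∈ (chartAt ℂ p).source)
    (hh : ContinuousAt (h ∘ (chartAt ℂ p).symm) (chartAt ℂ p q)) : ContinuousAt h q := by
  refine (hh.comp ((chartAt ℂ p).continuousAt hq)).congr ?_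
  filter_upwards [(chartAt ℂ p).open_source.mem_nhds hq] with z hz
  simp [(chartAt ℂ p).left_inv hz]

variable [IsManifold 𝓘(ℂ, ℂ) ω M]

theorem contDiffOn_chart_transition (p q : M) :
    ContDiffOn ℂ ω (chartAt ℂ p ∘ (chartAt ℂ q).symm)
      ((chartAt ℂ q).symm ≫ₕ chartAt ℂ p).source := by
  have := contDiffOn_ext_coord_change (I := 𝓘(ℂ, ℂ)) (n := ω) p q
  simpa [extChartAt, Function.comp_def] using this

/-- The derivative at `q` of the coordinate change from the preferred chart at `q` to the one
at `p`. -/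
def chartDeriv (p q : M) : ℂ := deriv (chartAt ℂ p ∘ (chartAt ℂ q).symm) (chartAt ℂ q q)

theorem hasDerivAt_chart_transition {p q : M} (hq : q ∈ (chartAt ℂ p).source) :
    HasDerivAt (chartAt ℂ p ∘ (chartAt ℂ q).symm) (chartDeriv p q) (chartAt ℂ q q) := by
  have hmem : chartAt ℂ q q ∈ ((chartAt ℂ q).symm ≫ₕ chartAt ℂ p).source := by
    simp [hq]
  exact (((contDiffOn_chart_transition p q).differentiableOn (by simp)).differentiableAt
    (((chartAt ℂ q).symm ≫ₕ chartAt ℂ p).open_source.mem_nhds hmem)).hasDerivAt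

theorem chartDeriv_ne_zero {p q : M} (hq : q ∈ (chartAt ℂ p).source) : chartDeriv p q ≠ 0 := by
  have h1 := hasDerivAt_chart_transition hq
  have hmem : chartAt ℂ p q ∈ ((chartAt ℂ p).symm ≫ₕ chartAt ℂ q).source := by
    simp [hq]
  have h2 := (((contDiffOn_chart_transition q p).differentiableOn (by simp)).differentiableAt
    (((chartAt ℂ p).symm ≫ₕ chartAt ℂ q).open_source.mem_nhds hmem)).hasDerivAt
  have hpq : chartAt ℂ p q = (chartAt ℂ p ∘ (chartAt ℂ q).symm) (chartAt ℂ q q) := by simp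
  rw [hpq] at h2
  have h3 := h2.comp _ h1
  have h4 : (chartAt ℂ q ∘ (chartAt ℂ p).symm) ∘ (chartAt ℂ p ∘ (chartAt ℂ q).symm)
      =ᶠ[𝓝 (chartAt ℂ q q)] id := by
    have hm : chartAt ℂ q q ∈ ((chartAt ℂ q).symm ≫ₕ chartAt ℂ p).source := by simp [hq]
    filter_upwards [((chartAt ℂ q).symm ≫ₕ chartAt ℂ p).open_source.mem_nhds hm] with z hz
    simp only [OpenPartialHomeomorph.trans_source, OpenPartialHomeomorph.symm_source,
      Set.mem_inter_iff, Set.mem_preimage] at hz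
    simp [(chartAt ℂ p).left_inv hz.2, (chartAt ℂ q).right_inv hz.1]
  have h5 := h3.unique ((hasDerivAt_id _).congr_of_eventuallyEq h4)
  intro h0
  rw [h0, mul_zero] at h5
  exact zero_ne_one h5

theorem hasFDerivAt_comp_chart_transition {h : M → E} {p q : M} (hq : q ∈ (chartAt ℂ p).source)
    (hh : DifferentiableAt ℝ (h ∘ (chartAt ℂ p).symm) (chartAt ℂ p q)) :
    HasFDerivAt (h ∘ (chartAt ℂ q).symm) ((fderiv ℝ (h ∘ (chartAt ℂ p).symm) (chartAt ℂ p q)).comp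
      (chartDeriv p q • (1 : ℂ →L[ℝ] ℂ))) (chartAt ℂ q q) := by
  have h1 := (hasDerivAt_chart_transition hq).complexToReal_fderiv
  have hpq : chartAt ℂ p q = (chartAt ℂ p ∘ (chartAt ℂ q).symm) (chartAt ℂ q q) := by simp
  have h2 := hh.hasFDerivAt
  rw [hpq] at h2 ⊢
  exact (h2.comp _ h1).congr_of_eventuallyEq (comp_chart_transition_eventuallyEq hq)

theorem mdifferentiableAt_of_chart {h : M → E} {p q : M} (hq : q ∈ (chartAt ℂ p).source)
    (hh : DifferentiableAt ℝ (h ∘ (chartAt ℂ p).symm) (chartAt ℂ p q)) :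
    MDifferentiableAt 𝓘(ℝ, ℂ) 𝓘(ℝ, E) h q :=
  mdifferentiableAt_iff_chart.2 ⟨continuousAt_of_chart hq hh.continuousAt,
    (hasFDerivAt_comp_chart_transition hq hh).differentiableAt⟩

/-- `dif` at q is computed in the preferred chart at q. Reading it in the chart at p multiplies
tangent vectors by a complex number, so identities involving multiplication by i survive. -/
theorem dif_eq_fderiv_chart {h : M → E} {p q : M} (hq : q ∈ (chartAt ℂ p).source)
    (hh : DifferentiableAt ℝ (h ∘ (chartAt ℂ p).symm) (chartAt ℂ p q)) (X : ℂ) :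
    dif h q X = fderiv ℝ (h ∘ (chartAt ℂ p).symm) (chartAt ℂ p q) (chartDeriv p q * X) := by
  rw [dif_eq_fderiv_chartAt (mdifferentiableAt_of_chart hq hh),
    (hasFDerivAt_comp_chart_transition hq hh).fderiv]
  simp

theorem contDiffAt_chart {h : M → E} {p q : M} {n : WithTop ℕ∞}
    (hq : q ∈ (chartAt ℂ p).source) (hh : ContMDiffAt 𝓘(ℝ, ℂ) 𝓘(ℝ, E) n h q) :
    ContDiffAt ℝ n (h ∘ (chartAt ℂ p).symm) (chartAt ℂ p q) := by
  have h1 := (contMDiffAt_iff_chart.1 hh).2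
  have hm : chartAt ℂ p q ∈ ((chartAt ℂ p).symm ≫ₕ chartAt ℂ q).source := by simp [hq]
  have h2 : ContDiffAt ℝ n (chartAt ℂ q ∘ (chartAt ℂ p).symm) (chartAt ℂ p q) :=
    (((contDiffOn_chart_transition q p).contDiffAt
      (((chartAt ℂ p).symm ≫ₕ chartAt ℂ q).open_source.mem_nhds hm)).restrict_scalars ℝ).of_le
      le_top
  have hpq : chartAt ℂ q q = (chartAt ℂ q ∘ (chartAt ℂ p).symm) (chartAt ℂ p q) := by
    simp [(chartAt ℂ p).left_inv hq]
  rw [hpq] at h1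
  refine (h1.comp _ h2).congr_of_eventuallyEq ?_
  filter_upwards [((chartAt ℂ p).symm ≫ₕ chartAt ℂ q).open_source.mem_nhds hm] with z hz
  simp only [OpenPartialHomeomorph.trans_source, OpenPartialHomeomorph.symm_source,
    Set.mem_inter_iff, Set.mem_preimage] at hz
  simp [(chartAt ℂ q).left_inv hz.2]

theorem differentiableAt_chart {h : M → E} {p q : M} (hq : q ∈ (chartAt ℂ p).source)
    (hh : MDifferentiableAt 𝓘(ℝ, ℂ) 𝓘(ℝ, E) h q) :
    DifferentiableAt ℝ (h ∘ (chartAt ℂ p).symm) (chartAt ℂ p q) := by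
  have h1 := (mdifferentiableAt_iff_chart.1 hh).2
  have hm : chartAt ℂ p q ∈ ((chartAt ℂ p).symm ≫ₕ chartAt ℂ q).source := by simp [hq]
  have h2 : DifferentiableAt ℝ (chartAt ℂ q ∘ (chartAt ℂ p).symm) (chartAt ℂ p q) :=
    (((contDiffOn_chart_transition q p).differentiableOn (by simp)).differentiableAt
      (((chartAt ℂ p).symm ≫ₕ chartAt ℂ q).open_source.mem_nhds hm)).restrictScalars ℝ
  have hpq : chartAt ℂ q q = (chartAt ℂ q ∘ (chartAt ℂ p).symm) (chartAt ℂ p q) := by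
    simp [(chartAt ℂ p).left_inv hq]
  rw [hpq] at h1
  refine (h1.comp _ h2).congr_of_eventuallyEq ?_
  filter_upwards [((chartAt ℂ p).symm ≫ₕ chartAt ℂ q).open_source.mem_nhds hm] with z hz
  simp only [OpenPartialHomeomorph.trans_source, OpenPartialHomeomorph.symm_source,
    Set.mem_inter_iff, Set.mem_preimage] at hz
  simp [(chartAt ℂ q).left_inv hz.2]

theorem Smooth.contDiffOn_chart {h : M → E} (hh : Smooth h) (p : M) :
    ContDiffOn ℝ ∞ (h ∘ (chartAt ℂ p).symm) (chartAt ℂ p).target := by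
  intro z hz
  have h1 := contDiffAt_chart (p := p) ((chartAt ℂ p).map_target hz) (hh _)
  rw [(chartAt ℂ p).right_inv hz] at h1
  exact h1.contDiffWithinAt

theorem Smooth.differentiableAt_chart {h : M → E} (hh : Smooth h) {p q : M}
    (hq : q ∈ (chartAt ℂ p).source) :
    DifferentiableAt ℝ (h ∘ (chartAt ℂ p).symm) (chartAt ℂ p q) :=
  DarbouxCMC.differentiableAt_chart hq (hh.mdifferentiableAt q)

/-- In the chart at `p`, the derivative of a function in terms of its differential. -/
theorem fderiv_chart_eq_dif {h : M → E} {p q : M} (hq : q ∈ (chartAt ℂ p).source)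
    (hh : MDifferentiableAt 𝓘(ℝ, ℂ) 𝓘(ℝ, E) h q) (X : ℂ) :
    fderiv ℝ (h ∘ (chartAt ℂ p).symm) (chartAt ℂ p q) X = dif h q ((chartDeriv p q)⁻¹ * X) := by
  rw [dif_eq_fderiv_chart hq (differentiableAt_chart hq hh),
    mul_inv_cancel_left₀ (chartDeriv_ne_zero hq)]

/-- A function whose differential vanishes near `p` is constant near `p`. -/
theorem eventually_eq_of_dif_eq_zero {h : M → E} {p : M}
    (hh : ∀ᶠ q in 𝓝 p, MDifferentiableAt 𝓘(ℝ, ℂ) 𝓘(ℝ, E) h q ∧ ∀ X, dif h q X = 0) :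
    ∀ᶠ q in 𝓝 p, h q = h p := by
  have hps := mem_chart_source ℂ p
  have h1 : ∀ᶠ z in 𝓝 (chartAt ℂ p p), DifferentiableAt ℝ (h ∘ (chartAt ℂ p).symm) z ∧
      fderiv ℝ (h ∘ (chartAt ℂ p).symm) z = 0 := by
    have h2 := (chartAt ℂ p).continuousAt_symm ((chartAt ℂ p).map_source hps)
    rw [ContinuousAt, (chartAt ℂ p).left_inv hps] at h2
    filter_upwards [h2.eventually hh,
      (chartAt ℂ p).open_target.mem_nhds ((chartAt ℂ p).map_source hps)] with z hz hzt
    have hzs := (chartAt ℂ p).map_target hzt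
    have h3 := DarbouxCMC.differentiableAt_chart hzs hz.1
    have h4 := fun X => fderiv_chart_eq_dif hzs hz.1 X
    rw [(chartAt ℂ p).right_inv hzt] at h3 h4
    exact ⟨h3, ContinuousLinearMap.ext fun X => (h4 X).trans (hz.2 _)⟩
  obtain ⟨r, hr, hball⟩ := Metric.eventually_nhds_iff_ball.1 h1
  filter_upwards [((chartAt ℂ p).continuousAt hps).eventually (Metric.ball_mem_nhds _ hr),
    (chartAt ℂ p).open_source.mem_nhds hps] with q hq hqs
  have := (convex_ball (chartAt ℂ p p) r).is_const_of_fderivWithin_eq_zero (𝕜 := ℝ)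
    (fun z hz => (hball z hz).1.differentiableWithinAt) (fun z hz => by
      rw [fderivWithin_of_isOpen Metric.isOpen_ball hz]; exact (hball z hz).2) hq
    (Metric.mem_ball_self hr)
  simpa [(chartAt ℂ p).left_inv hqs, (chartAt ℂ p).left_inv hps] using this

end Charts

/-! ### Gluing on simply connected surfaces and the system dα = -df S α. -/

/-- On a simply connected space a family of local frames that differ by locally constant elements
has a global section, that is locally a constant multiple of each frame. -/
theorem exists_global_section {M : Type*} [TopologicalSpace M] [SimplyConnectedSpace M]
    [LocallyPathConnectedSpace M] {G : Type*} [Group G] (U : M → Set M) (hU : ∀ p, IsOpen (U p))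
    (hmem : ∀ p, p ∈ U p) (α : M → M → G)
    (hα : ∀ i j, ∀ x ∈ U i ∩ U j, ∀ᶠ y in 𝓝 x, (α j y)⁻¹ * α i y = (α j x)⁻¹ * α i x)
    (p₀ : M) (g₀ : G) :
    ∃ s : M → G, s p₀ = g₀ ∧ ∀ x, ∃ v, ∀ᶠ y in 𝓝 x, s y = α x y * v := by
  -- With the discrete topology on G the locally constant transition functions define a bundle with
  -- discrete fibre, which is a covering. The required section is the lift of the identity map of
  -- the simply connected base.
  let _ : TopologicalSpace G := ⊥
  have : DiscreteTopology G := ⟨rfl⟩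
  let Z : FiberBundleCore M M G :=
    { baseSet := U
      isOpen_baseSet := hU
      indexAt := id
      mem_baseSet_at := hmem
      coordChange := fun i j x v => (α j x)⁻¹ * α i x * v
      coordChange_self := fun i x _ v => by simp
      continuousOn_coordChange := by
        rintro i j ⟨x, v⟩ ⟨hx, -⟩
        refine ContinuousAt.continuousWithinAt ?_
        have h1 : (fun p : M × G => (α j p.1)⁻¹ * α i p.1 * p.2) =ᶠ[𝓝 (x, v)]
            fun p => (α j x)⁻¹ * α i x * p.2 := by
          filter_upwards [continuousAt_fst.eventually (hα i j x hx)] with p hp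
          rw [hp]
        exact (ContinuousAt.congr
          ((continuous_of_discreteTopology (f := fun g : G => (α j x)⁻¹ * α i x * g)).continuousAt.comp
            continuousAt_snd) h1.symm)
      coordChange_comp := fun i j k x _ v => by simp [mul_assoc] }
  have hcov : IsCoveringMap (Bundle.TotalSpace.proj : Bundle.TotalSpace G Z.Fiber → M) :=
    FiberBundle.isCoveringMap
  obtain ⟨S, ⟨hS0, hS⟩, -⟩ := hcov.existsUnique_continuousMap_lifts (ContinuousMap.id M) p₀
    (⟨p₀, ((α p₀ p₀)⁻¹ * g₀ : G)⟩ : Bundle.TotalSpace G Z.Fiber) rfl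
  have hproj : ∀ y, (S y).1 = y := fun y => congrFun hS y
  let s' : M → G := fun y => (S y).2
  refine ⟨fun y => α y y * s' y, ?_, fun x => ?_⟩
  · have hsnd : ∀ T : Bundle.TotalSpace G Z.Fiber, T = ⟨p₀, ((α p₀ p₀)⁻¹ * g₀ : G)⟩ →
        (T.2 : G) = (α p₀ p₀)⁻¹ * g₀ := by rintro _ rfl; rfl
    have : s' p₀ = (α p₀ p₀)⁻¹ * g₀ := hsnd _ hS0
    simp [this]
  · have hc : ContinuousAt (fun y => (Z.localTriv x (S y)).2) x := by
      have h1 : ContinuousAt (Z.localTriv x) (S x) := by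
        refine (Z.localTriv x).continuousAt ?_
        rw [Z.mem_localTriv_source, hproj]
        exact hmem x
      exact continuousAt_snd.comp (h1.comp S.continuous.continuousAt)
    refine ⟨(Z.localTriv x (S x)).2, ?_⟩
    have h2 : ∀ᶠ y in 𝓝 x, (Z.localTriv x (S y)).2 = (Z.localTriv x (S x)).2 := by
      exact (hc.eventually (isOpen_discrete {(Z.localTriv x (S x)).2} |>.mem_nhds rfl)).mono
        fun y hy => hy
    filter_upwards [h2] with y hy
    rw [← hy, Z.localTriv_apply]
    show α y y * s' y = α x y * ((α x (S y).1)⁻¹ * α (S y).1 (S y).1 * s' y)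
    rw [hproj]
    group

section ParallelSection

theorem two_le_infty : (2 : WithTop ℕ∞) ≤ ∞ := by
  have : ((2 : ℕ∞) : WithTop ℕ∞) ≤ ∞ := WithTop.coe_le_coe.2 le_top
  exact this

variable {M : Type*} [TopologicalSpace M] [ChartedSpace ℂ M]

/-- The one-form `-df S` in the chart at `p`. -/
def chartForm (f S : M → ℍ[ℝ]) (p : M) (z : ℂ) : ℂ →L[ℝ] ℍ[ℝ] :=
  -((ContinuousLinearMap.mul ℝ ℍ[ℝ]).flip ((S ∘ (chartAt ℂ p).symm) z)).comp
    (fderiv ℝ (f ∘ (chartAt ℂ p).symm) z)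

theorem chartForm_apply (f S : M → ℍ[ℝ]) (p : M) (z X : ℂ) :
    chartForm f S p z X = -(fderiv ℝ (f ∘ (chartAt ℂ p).symm) z X * S ((chartAt ℂ p).symm z)) :=
  rfl

variable [IsManifold 𝓘(ℂ, ℂ) ω M]

theorem contDiffOn_chartForm {f S : M → ℍ[ℝ]} (hf : Smooth f) (hS : Smooth S) (p : M) :
    ContDiffOn ℝ ∞ (chartForm f S p) (chartAt ℂ p).target := by
  have h1 : ContDiffOn ℝ ∞ (fderiv ℝ (f ∘ (chartAt ℂ p).symm)) (chartAt ℂ p).target :=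
    (hf.contDiffOn_chart p).fderiv_of_isOpen (chartAt ℂ p).open_target (by simp)
  have h2 : ContDiffOn ℝ ∞ (fun z => (ContinuousLinearMap.mul ℝ ℍ[ℝ]).flip
      ((S ∘ (chartAt ℂ p).symm) z)) (chartAt ℂ p).target :=
    (ContinuousLinearMap.contDiff _).comp_contDiffOn (hS.contDiffOn_chart p)
  exact (h2.clm_comp h1).neg

theorem fderiv_chartForm_apply {f S : M → ℍ[ℝ]} (hf : Smooth f) (hS : Smooth S) (p : M) {z : ℂ}
    (hz : z ∈ (chartAt ℂ p).target) (X Y : ℂ) :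
    fderiv ℝ (chartForm f S p) z X Y =
      -(fderiv ℝ (fderiv ℝ (f ∘ (chartAt ℂ p).symm)) z X Y * S ((chartAt ℂ p).symm z) +
        fderiv ℝ (f ∘ (chartAt ℂ p).symm) z Y * fderiv ℝ (S ∘ (chartAt ℂ p).symm) z X) := by
  have hnhds := (chartAt ℂ p).open_target.mem_nhds hz
  have h0 : DifferentiableAt ℝ (chartForm f S p) z :=
    ((contDiffOn_chartForm hf hS p).contDiffAt hnhds).differentiableAt (by simp)
  have h1 : DifferentiableAt ℝ (fderiv ℝ (f ∘ (chartAt ℂ p).symm)) z :=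
    (((hf.contDiffOn_chart p).fderiv_of_isOpen (chartAt ℂ p).open_target
      (m := ∞) (by simp)).contDiffAt hnhds).differentiableAt (by simp)
  have h2 : DifferentiableAt ℝ (S ∘ (chartAt ℂ p).symm) z :=
    ((hS.contDiffOn_chart p).contDiffAt hnhds).differentiableAt (by simp)
  have h3 := h0.hasFDerivAt.clm_apply (hasFDerivAt_const Y z)
  have h4 := ((h1.hasFDerivAt.clm_apply (hasFDerivAt_const Y z)).mul' h2.hasFDerivAt).neg
  have h5 := congrArg (fun L : ℂ →L[ℝ] ℍ[ℝ] => L X) (h3.unique h4)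
  simp only [Function.comp_apply] at h5
  simpa [add_comm] using h5

/-- Integrability of the system `dα = -df S α`. -/
def IsIntegrablePair (f S : M → ℍ[ℝ]) : Prop :=
  ∀ p X Y, dif f p X * dif S p Y - dif f p Y * dif S p X =
    dif f p X * S p * (dif f p Y * S p) - dif f p Y * S p * (dif f p X * S p)

/-- In dη for η = -df S the second derivatives of f cancel by symmetry, leaving df ∧ dS;
integrability identifies this with η ∧ η. -/
theorem chartForm_flat {f S : M → ℍ[ℝ]} (hf : Smooth f) (hS : Smooth S)
    (hfS : IsIntegrablePair f S) (p : M) {z : ℂ} (hz : z ∈ (chartAt ℂ p).target) (X Y : ℂ) :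
    fderiv ℝ (chartForm f S p) z X Y - fderiv ℝ (chartForm f S p) z Y X =
      chartForm f S p z X * chartForm f S p z Y - chartForm f S p z Y * chartForm f S p z X := by
  have hq := (chartAt ℂ p).map_target hz
  have hzq := (chartAt ℂ p).right_inv hz
  have hsymm : fderiv ℝ (fderiv ℝ (f ∘ (chartAt ℂ p).symm)) z X Y =
      fderiv ℝ (fderiv ℝ (f ∘ (chartAt ℂ p).symm)) z Y X :=
    (((hf.contDiffOn_chart p).contDiffAt
      ((chartAt ℂ p).open_target.mem_nhds hz)).isSymmSndFDerivAt (by simpa using two_le_infty)).eq X Y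
  rw [fderiv_chartForm_apply hf hS p hz, fderiv_chartForm_apply hf hS p hz, hsymm]
  simp only [chartForm_apply]
  have hF := fun X => fderiv_chart_eq_dif hq (hf.mdifferentiableAt _) X
  have hG := fun X => fderiv_chart_eq_dif hq (hS.mdifferentiableAt _) X
  rw [hzq] at hF hG
  have := hfS ((chartAt ℂ p).symm z) ((chartDeriv p ((chartAt ℂ p).symm z))⁻¹ * X)
    ((chartDeriv p ((chartAt ℂ p).symm z))⁻¹ * Y)
  simp only [hF, hG, neg_mul_neg, ← this]
  abel

theorem exists_local_parallel {f S : M → ℍ[ℝ]} (hf : Smooth f) (hS : Smooth S)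
    (hfS : IsIntegrablePair f S) (p : M) : ∃ U : Set M, IsOpen U ∧ p ∈ U ∧ ∃ α : M → ℍ[ℝ],
      (∀ q ∈ U, α q ≠ 0) ∧ ∀ q ∈ U, MDifferentiableAt 𝓘(ℝ, ℂ) 𝓘(ℝ, ℍ[ℝ]) α q ∧
        ∀ X, dif α q X = -(dif f q X * S q * α q) := by
  obtain ⟨R, hR, hRs, α, hα1, hα⟩ := exists_local_frame (chartAt ℂ p).open_target
    ((contDiffOn_chartForm hf hS p).of_le two_le_infty)
    (fun z hz X Y => chartForm_flat hf hS hfS p hz X Y) (mem_chart_target ℂ p)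
  refine ⟨(chartAt ℂ p).source ∩ chartAt ℂ p ⁻¹' Metric.ball (chartAt ℂ p p) R,
    (chartAt ℂ p).isOpen_inter_preimage Metric.isOpen_ball,
    ⟨mem_chart_source ℂ p, Metric.mem_ball_self hR⟩, α ∘ chartAt ℂ p, ?_, ?_⟩
  · rintro q ⟨-, hq⟩ h0
    have := hα1 _ hq
    simp only [Function.comp_apply] at h0
    rw [h0] at this
    simp at this
  · rintro q ⟨hqs, hq⟩
    have h1 : (α ∘ chartAt ℂ p) ∘ (chartAt ℂ p).symm =ᶠ[𝓝 (chartAt ℂ p q)] α := by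
      filter_upwards [(chartAt ℂ p).open_target.mem_nhds ((chartAt ℂ p).map_source hqs)] with z hz
      simp [(chartAt ℂ p).right_inv hz]
    have h2 := (hα _ hq).congr_of_eventuallyEq h1
    refine ⟨mdifferentiableAt_of_chart hqs h2.differentiableAt, fun X => ?_⟩
    rw [dif_eq_fderiv_chart hqs h2.differentiableAt, h2.fderiv,
      dif_eq_fderiv_chart hqs (hf.differentiableAt_chart hqs)]
    simp [chartForm_apply, (chartAt ℂ p).left_inv hqs]

/-- Bootstrapping: the equation expresses the derivative of α through α and smooth data, so Cⁿ
regularity implies Cⁿ⁺¹. -/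
theorem smooth_of_parallel {f S α : M → ℍ[ℝ]} (hf : Smooth f) (hS : Smooth S)
    (hα : ∀ q, MDifferentiableAt 𝓘(ℝ, ℂ) 𝓘(ℝ, ℍ[ℝ]) α q)
    (hd : ∀ q X, dif α q X = -(dif f q X * S q * α q)) : Smooth α := by
  intro p
  have hopen := (chartAt ℂ p).open_target
  have hdiff : DifferentiableOn ℝ (α ∘ (chartAt ℂ p).symm) (chartAt ℂ p).target := by
    intro z hz
    have := differentiableAt_chart ((chartAt ℂ p).map_target hz) (hα _)
    rw [(chartAt ℂ p).right_inv hz] at this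
    exact this.differentiableWithinAt
  have hfd : ∀ z ∈ (chartAt ℂ p).target, fderiv ℝ (α ∘ (chartAt ℂ p).symm) z =
      ((ContinuousLinearMap.mul ℝ ℍ[ℝ]).flip ((α ∘ (chartAt ℂ p).symm) z)).comp
        (chartForm f S p z) := by
    intro z hz
    have hq := (chartAt ℂ p).map_target hz
    ext1 X
    have h1 := fderiv_chart_eq_dif hq (hα _) X
    have h2 := fderiv_chart_eq_dif hq (hf.mdifferentiableAt _) X
    rw [(chartAt ℂ p).right_inv hz] at h1 h2
    rw [h1, hd, ← h2]
    simp [chartForm_apply]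
  have hn : ∀ n : ℕ, ContDiffOn ℝ n (α ∘ (chartAt ℂ p).symm) (chartAt ℂ p).target := by
    intro n
    induction n with
    | zero => exact contDiffOn_zero.2 hdiff.continuousOn
    | succ n ih =>
      push_cast
      rw [contDiffOn_succ_iff_fderiv_of_isOpen hopen]
      refine ⟨hdiff, by simp, ?_⟩
      have h2 : ContDiffOn ℝ n (fun z => (ContinuousLinearMap.mul ℝ ℍ[ℝ]).flip
          ((α ∘ (chartAt ℂ p).symm) z)) (chartAt ℂ p).target :=
        (ContinuousLinearMap.contDiff _).comp_contDiffOn ih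
      exact (h2.clm_comp ((contDiffOn_chartForm hf hS p).of_le
        (by exact_mod_cast le_top))).congr hfd
  refine contMDiffAt_iff_chart.2 ⟨(hα p).continuousAt, ?_⟩
  exact (contDiffOn_infty.2 hn).contDiffAt (hopen.mem_nhds (mem_chart_target ℂ p))

/-- On a simply connected Riemann surface, the integrable system `dα = -df S α` has a nowhere
vanishing solution with any given nonzero initial value. -/
theorem exists_parallel_section [SimplyConnectedSpace M] {f S : M → ℍ[ℝ]} (hf : Smooth f)
    (hS : Smooth S) (hfS : IsIntegrablePair f S) (p₀ : M) {c : ℍ[ℝ]} (hc : c ≠ 0) :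
    ∃ α : M → ℍ[ℝ], Smooth α ∧ α p₀ = c ∧ (∀ p, α p ≠ 0) ∧
      ∀ p X, dif α p X = -(dif f p X * S p * α p) := by
  have : LocallyPathConnectedSpace M := ChartedSpace.locallyPathConnectedSpace ℂ M
  classical
  choose U hU hmem β hβ0 hβ using fun p => exists_local_parallel hf hS hfS p
  -- The value 1 at zeros of `β p` is a dummy, since `β p` has none on `U p`.
  let k : M → M → ℍ[ℝ]ˣ := fun p q => if h : β p q = 0 then 1 else Units.mk0 (β p q) h
  have hk : ∀ p, ∀ q ∈ U p, (k p q : ℍ[ℝ]) = β p q := by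
    intro p q hq
    simp [k, hβ0 p q hq]
  obtain ⟨s, hs0, hs⟩ := exists_global_section U hU hmem k (by
    rintro i j x ⟨hi, hj⟩
    -- Two solutions of the same left-linear system differ by a right factor with zero differential.
    have h1 : ∀ᶠ y in 𝓝 x, (β j y)⁻¹ * β i y = (β j x)⁻¹ * β i x := by
      refine eventually_eq_of_dif_eq_zero (h := fun y => (β j y)⁻¹ * β i y) ?_
      filter_upwards [(hU i).mem_nhds hi, (hU j).mem_nhds hj] with y hyi hyj
      have hinv := mdifferentiableAt_inv (hβ j y hyj).1 (hβ0 j y hyj)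
      refine ⟨mdifferentiableAt_mul hinv (hβ i y hyi).1, fun X => ?_⟩
      rw [dif_mul hinv (hβ i y hyi).1, dif_inv (hβ j y hyj).1 (hβ0 j y hyj), (hβ i y hyi).2,
        (hβ j y hyj).2]
      simp [mul_assoc, hβ0 j y hyj]
    filter_upwards [h1, (hU i).mem_nhds hi, (hU j).mem_nhds hj] with y hy hyi hyj
    apply Units.ext
    simpa [hk i y hyi, hk j y hyj, hk i x hi, hk j x hj] using hy) p₀ (Units.mk0 c hc)
  have hs' : ∀ x, ∃ v : ℍ[ℝ], (fun y => (s y : ℍ[ℝ])) =ᶠ[𝓝 x] fun y => β x y * v := by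
    intro x
    obtain ⟨v, hv⟩ := hs x
    refine ⟨v, ?_⟩
    filter_upwards [hv, (hU x).mem_nhds (hmem x)] with y hy hyx
    rw [hy, Units.val_mul, hk x y hyx]
  have hmd : ∀ x, MDifferentiableAt 𝓘(ℝ, ℂ) 𝓘(ℝ, ℍ[ℝ]) (fun y => (s y : ℍ[ℝ])) x := by
    intro x
    obtain ⟨v, hv⟩ := hs' x
    exact (mdifferentiableAt_mul (hβ x x (hmem x)).1
      (mdifferentiableAt_const (c := v))).congr_of_eventuallyEq hv
  have hdif : ∀ x X, dif (fun y => (s y : ℍ[ℝ])) x X = -(dif f x X * S x * s x) := by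
    intro x X
    obtain ⟨v, hv⟩ := hs' x
    rw [dif_congr hv, dif_mul (hβ x x (hmem x)).1 (mdifferentiableAt_const (c := v)), dif_const,
      (hβ x x (hmem x)).2, show (s x : ℍ[ℝ]) = β x x * v from hv.self_of_nhds]
    simp [mul_assoc]
  exact ⟨fun y => s y, smooth_of_parallel hf hS hmd hdif, by simp [hs0], fun p => (s p).ne_zero,
    hdif⟩

end ParallelSection

/-! ### Quaternionic line bundles and enveloping sphere congruences. -/

section LineBundles

variable {M : Type*}

theorem mem_lineBundle {f : M → ℍ[ℝ]} {p : M} {v : Fin 2 → ℍ[ℝ]} :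
    v ∈ lineBundle f p ↔ v 0 = f p * v 1 := by
  rw [lineBundle, Submodule.mem_span_singleton]
  constructor
  · rintro ⟨c, rfl⟩
    simp [psi]
  · intro h
    refine ⟨MulOpposite.op (v 1), ?_⟩
    ext1 i
    fin_cases i <;> simp [psi, h]

theorem mkQ_lineBundle_eq {f : M → ℍ[ℝ]} {p : M} {v w : Fin 2 → ℍ[ℝ]} :
    (lineBundle f p).mkQ v = (lineBundle f p).mkQ w ↔ v 0 - w 0 = f p * (v 1 - w 1) := by
  rw [Submodule.mkQ_apply, Submodule.mkQ_apply, Submodule.Quotient.eq, mem_lineBundle]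
  rfl

theorem mkQ_lineBundle_eq_zero {f : M → ℍ[ℝ]} {p : M} {v : Fin 2 → ℍ[ℝ]} :
    (lineBundle f p).mkQ v = 0 ↔ v 0 = f p * v 1 := by
  rw [Submodule.mkQ_apply, Submodule.Quotient.mk_eq_zero, mem_lineBundle]

variable [TopologicalSpace M] [ChartedSpace ℂ M]

theorem smooth_pi {F : M → Fin 2 → ℍ[ℝ]} : Smooth F ↔ ∀ i, Smooth fun p => F p i :=
  contMDiff_pi_space

theorem dif_pi {F : M → Fin 2 → ℍ[ℝ]} (hF : Smooth F) (p : M) (X : ℂ) (i : Fin 2) :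
    dif F p X i = dif (fun q => F q i) p X := by
  have h1 := mdifferentiableAt_iff_chart.1 (hF.mdifferentiableAt p)
  rw [dif_eq_fderiv_chartAt (hF.mdifferentiableAt p),
    dif_eq_fderiv_chartAt ((smooth_pi.1 hF i).mdifferentiableAt p)]
  have h2 := (hasFDerivAt_pi'.1 h1.2.hasFDerivAt) i
  exact (congrArg (fun f : ℂ →L[ℝ] ℍ[ℝ] => f X) h2.fderiv).symm

theorem smooth_psi {f : M → ℍ[ℝ]} (hf : Smooth f) : Smooth (psi f) := by
  rw [smooth_pi]
  intro i
  fin_cases i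
  · exact hf
  · exact smooth_const 1

theorem dif_psi {f : M → ℍ[ℝ]} (hf : Smooth f) (p : M) (X : ℂ) :
    dif (psi f) p X = ![dif f p X, 0] := by
  ext1 i
  rw [dif_pi (smooth_psi hf)]
  fin_cases i
  · rfl
  · exact dif_const (1 : ℍ[ℝ]) p X

/-- An enveloping sphere congruence acts on `L` by right multiplication with the right normal. -/
theorem Envelopes.right_normal {S : M → Matrix (Fin 2) (Fin 2) ℍ[ℝ]} {f : M → ℍ[ℝ]}
    (hf : Smooth f) (hS : Envelopes S f) (p : M) (X : ℂ) :
    dif f p (Complex.I * X) = dif f p X * (S p 1 0 * f p + S p 1 1) := by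
  have h := mkQ_lineBundle_eq.1
    (hS.right p X (psi f p) (Submodule.mem_span_singleton_self _))
  simpa [hodge, deltaRep, dif_psi hf, psi, Matrix.mulVec, dotProduct, Fin.sum_univ_two,
    sub_eq_zero] using h

theorem Envelopes.left_normal {S : M → Matrix (Fin 2) (Fin 2) ℍ[ℝ]} {f : M → ℍ[ℝ]}
    (hf : Smooth f) (hS : Envelopes S f) (p : M) (X : ℂ) :
    dif f p (Complex.I * X) = (S p 0 0 - f p * S p 1 0) * dif f p X := by
  have h := mkQ_lineBundle_eq.1
    (hS.left p X (psi f p) (Submodule.mem_span_singleton_self _))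
  simp only [hodge, deltaRep, dif_psi hf, psi, Matrix.mulVec, dotProduct, Fin.sum_univ_two] at h
  simp at h
  rw [sub_mul, mul_assoc, ← sub_eq_zero]
  rw [← sub_eq_zero] at h
  rw [← h]
  abel

theorem Envelopes.apply_psi {S : M → Matrix (Fin 2) (Fin 2) ℍ[ℝ]} {f : M → ℍ[ℝ]}
    (hS : Envelopes S f) (p : M) :
    S p 0 0 * f p + S p 0 1 = f p * (S p 1 0 * f p + S p 1 1) := by
  have h := mem_lineBundle.1 (hS.maps p (psi f p) (Submodule.mem_span_singleton_self _))
  simpa [psi, Matrix.mulVec, dotProduct, Fin.sum_univ_two] using h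

theorem IsCMCSurface.dif_ne_zero {f N : M → ℍ[ℝ]} (hf : IsCMCSurface f N) (p : M) {X : ℂ}
    (hX : X ≠ 0) : dif f p X ≠ 0 := fun h =>
  hX (hf.immersion p (h.trans (map_zero (mfderiv 𝓘(ℝ, ℂ) 𝓘(ℝ, ℍ[ℝ]) f p)).symm))

/-- Because f is immersed, df cancels and the envelope conditions for f fix S₁₀f + S₁₁ = -N and S₀₀
- fS₁₀ = N. Stability of the line of f♯ then gives NT = T(S₁₀f♯ + S₁₁), and the last factor is the
right normal of f♯. -/
theorem IsClassicalDarboux.right_normal {f N fs : M → ℍ[ℝ]} (hf : IsCMCSurface f N)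
    (hfs : IsClassicalDarboux f fs) (p : M) (X : ℂ) :
    dif fs p (Complex.I * X) =
      dif fs p X * ((fs p - f p)⁻¹ * N p * (fs p - f p)) := by
  obtain ⟨S, -, hSf, hSs⟩ := hfs.enveloped
  have hT : fs p - f p ≠ 0 := sub_ne_zero.2 (hfs.ne p).symm
  have hdf : dif f p 1 ≠ 0 := hf.dif_ne_zero p one_ne_zero
  have h1 : S p 1 0 * f p + S p 1 1 = -N p := by
    have := hSf.right_normal hf.gauss.smooth_f p 1
    have h2 := hf.gauss.right p 1
    rw [hodge] at h2
    rw [h2, ← mul_neg] at this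
    exact (mul_left_cancel₀ hdf this).symm
  have h2 : S p 0 0 - f p * S p 1 0 = N p := by
    have := hSf.left_normal hf.gauss.smooth_f p 1
    have h2 := hf.gauss.left p 1
    rw [hodge] at h2
    rw [h2] at this
    exact (mul_right_cancel₀ hdf this).symm
  have h3 := hSf.apply_psi p
  have h4 := hSs.apply_psi p
  rw [h1] at h3
  have h5 : S p 1 0 * fs p + S p 1 1 = -N p + S p 1 0 * (fs p - f p) := by
    rw [← h1]; noncomm_ring
  have h6 : S p 1 0 * (fs p - f p) = (fs p - f p)⁻¹ * N p * (fs p - f p) + N p := by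
    rw [h5] at h4
    have h7 : N p * (fs p - f p) =
        (fs p - f p) * (-N p + S p 1 0 * (fs p - f p)) := by
      have e1 : S p 0 0 * fs p + S p 0 1 =
          (S p 0 0 * f p + S p 0 1) + (S p 0 0 - f p * S p 1 0) * (fs p - f p) +
          f p * S p 1 0 * (fs p - f p) := by noncomm_ring
      rw [e1, h3, h2] at h4
      have e2 : N p * (fs p - f p) = (f p * -N p + N p * (fs p - f p) +
        f p * S p 1 0 * (fs p - f p)) - f p * -N p - f p * S p 1 0 * (fs p - f p) := by abel
      rw [e2, h4]
      noncomm_ring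
    rw [mul_assoc, h7, inv_mul_cancel_left₀ hT]
    abel
  rw [hSs.right_normal hfs.conformal.smooth, h5, h6]
  congr 1
  abel

end LineBundles

/-! ### The surface, its parallel surface, and parallel sections in coordinates. -/

section Surface

variable {M : Type*} [TopologicalSpace M] [ChartedSpace ℂ M] {f N : M → ℍ[ℝ]}

namespace IsCMCSurface

theorem dif_I (hf : IsCMCSurface f N) (p : M) (X : ℂ) :
    dif f p (Complex.I * X) = N p * dif f p X := hf.gauss.left p X

theorem dif_mul_normal (hf : IsCMCSurface f N) (p : M) (X : ℂ) :
    dif f p X * N p = -(N p * dif f p X) := by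
  rw [← hf.dif_I, ← neg_eq_iff_eq_neg]
  exact (hf.gauss.right p X).symm

theorem normal_mul_self (hf : IsCMCSurface f N) (p : M) : N p * N p = -1 := hf.gauss.sq_N p

theorem normal_mul_normal_mul (hf : IsCMCSurface f N) (p : M) (x : ℍ[ℝ]) :
    N p * (N p * x) = -x := by
  rw [← mul_assoc, hf.normal_mul_self, neg_one_mul]

theorem dif_normal_mul_normal (hf : IsCMCSurface f N) (p : M) (X : ℂ) :
    dif N p X * N p = -(N p * dif N p X) := by
  have h1 := dif_mul (hf.gauss.smooth_N.mdifferentiableAt p)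
    (hf.gauss.smooth_N.mdifferentiableAt p) X
  have h2 : (fun q => N q * N q) = fun _ => -1 := funext hf.gauss.sq_N
  rw [h2, dif_const] at h1
  exact eq_neg_of_add_eq_zero_left h1.symm

theorem dif_normal_I (hf : IsCMCSurface f N) (p : M) (X : ℂ) :
    dif N p (Complex.I * X) = -(N p * dif N p X) - (2 : ℝ) • (N p * dif f p X) := by
  have h := hf.meanCurvature p X
  rw [dNPrime, hodge, one_smul] at h
  have h2 : N p * dif N p (Complex.I * X) = dif N p X + (2 : ℝ) • dif f p X := by
    have h3 : (2 : ℝ) • ((1 / 2 : ℝ) • (dif N p X - N p * dif N p (Complex.I * X))) =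
        (2 : ℝ) • -dif f p X := by rw [h]
    rw [smul_smul] at h3
    norm_num at h3
    rw [sub_eq_iff_eq_add] at h3
    rw [h3]
    simp
  have h4 := congrArg (fun x => N p * x) h2
  simp only [hf.normal_mul_normal_mul, mul_add, mul_smul_comm] at h4
  rw [← neg_eq_iff_eq_neg.2 h4.symm]
  abel

theorem dif_parallel (hf : IsCMCSurface f N) (p : M) (X : ℂ) :
    dif (fun q => f q + N q) p X = dif f p X + dif N p X :=
  dif_add (hf.gauss.smooth_f.mdifferentiableAt p) (hf.gauss.smooth_N.mdifferentiableAt p) X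

/-- Mean curvature 1 gives *dN = -N dN - 2N df; adding *df = N df leaves -N dg. So dg has type
opposite to df. -/
theorem dif_parallel_I (hf : IsCMCSurface f N) (p : M) (X : ℂ) :
    dif (fun q => f q + N q) p (Complex.I * X) =
      -(N p * dif (fun q => f q + N q) p X) := by
  rw [hf.dif_parallel, hf.dif_parallel, hf.dif_I, hf.dif_normal_I, two_smul, mul_add]
  abel

theorem dif_parallel_mul_normal (hf : IsCMCSurface f N) (p : M) (X : ℂ) :
    dif (fun q => f q + N q) p X * N p = -(N p * dif (fun q => f q + N q) p X) := by
  rw [hf.dif_parallel, add_mul, hf.dif_mul_normal, hf.dif_normal_mul_normal, mul_add, neg_add]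

end IsCMCSurface

/-- The section `β` with `dα = -df β` for a `∇^μ`-parallel section `α`. -/
def muDual (N : M → ℍ[ℝ]) (μ : ℂ) (α : M → ℍ[ℝ]) (p : M) : ℍ[ℝ] :=
  (1 / 2 : ℝ) • (N p * α p * ((aOf μ - 1 : ℂ) : ℍ[ℝ]) + α p * ((bOf μ : ℂ) : ℍ[ℝ]))

theorem smooth_muDual {μ : ℂ} {α : M → ℍ[ℝ]} (hN : Smooth N) (hα : Smooth α) :
    Smooth (muDual N μ α) :=
  (((hN.mul hα).mul (smooth_const _)).add (hα.mul (smooth_const _))).const_smul _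

theorem nablaMu_eq (hf : IsCMCSurface f N) (μ : ℂ) (α : M → ℍ[ℝ]) (p : M) (X : ℂ) :
    nablaMu N μ α p X = dif α p X + dif f p X * muDual N μ α p := by
  have h := hf.meanCurvature p X
  rw [one_smul] at h
  rw [nablaMu, starA, h, muDual, smul_neg, neg_neg, smul_mul_assoc, mul_smul_comm]

/-- A section `α` of `V / L` that is `∇^μ`-parallel, has no zeros, and whose prolongation
spans the line bundle of `fs`. -/
structure IsMuSection (f N : M → ℍ[ℝ]) (μ : ℂ) (fs α : M → ℍ[ℝ]) : Prop where
  smooth : Smooth α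
  ne_zero : ∀ p, α p ≠ 0
  dif_eq : ∀ p X, dif α p X = -(dif f p X * muDual N μ α p)
  eq_mul : ∀ p, α p = (fs p - f p) * muDual N μ α p

/-- A lift of eα has the form (α + fF₁, F₁), and closedness modulo the line of f says dα = -df F₁.
Injectivity of df leaves F₁ = β, and membership in the line of f♯ reads α = Tβ. -/
theorem isMuDarboux_iff [Nonempty M] (hf : IsCMCSurface f N) {fs : M → ℍ[ℝ]} (hne : ∀ p, f p ≠ fs p)
    {μ : ℂ} : IsMuDarboux f N μ fs ↔ μ ≠ 0 ∧ ∃ α, IsMuSection f N μ fs α := by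
  have hT : ∀ p, fs p - f p ≠ 0 := fun p => sub_ne_zero.2 (hne p).symm
  constructor
  · rintro ⟨hμ, α, F, hα, -, hpar, hF, hspan⟩
    have hFi := smooth_pi.1 hF.smooth
    have hF0 : ∀ p, F p 0 = α p + f p * F p 1 := by
      intro p
      have := mkQ_lineBundle_eq.1 (hF.lift p)
      simp only [Matrix.cons_val_zero, Matrix.cons_val_one, sub_zero] at this
      rw [← this]
      abel
    have hdα : ∀ p X, dif α p X = -(dif f p X * muDual N μ α p) := fun p X => by
      have := hpar p X
      rw [nablaMu_eq hf] at this
      exact eq_neg_of_add_eq_zero_left this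
    have hβ : ∀ p, F p 1 = muDual N μ α p := by
      intro p
      have h1 := mkQ_lineBundle_eq_zero.1 (hF.closed p 1)
      rw [dif_pi hF.smooth, dif_pi hF.smooth] at h1
      have h2 : (fun q => F q 0) = fun q => α q + f q * F q 1 := funext hF0
      rw [h2, dif_add (hα.mdifferentiableAt p)
        ((hf.gauss.smooth_f.mul (hFi 1)).mdifferentiableAt p),
        dif_mul (hf.gauss.smooth_f.mdifferentiableAt p) ((hFi 1).mdifferentiableAt p), hdα] at h1
      have h3 : dif f p 1 * F p 1 = dif f p 1 * muDual N μ α p := by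
        rw [← sub_eq_zero] at h1 ⊢
        rw [← h1]
        abel
      exact mul_left_cancel₀ (hf.dif_ne_zero p one_ne_zero) h3
    have hTα : ∀ p, α p = (fs p - f p) * F p 1 := by
      intro p
      have h1 : F p 0 = fs p * F p 1 := by
        apply mem_lineBundle.1
        rw [← hspan p]
        exact Submodule.mem_span_singleton_self _
      rw [hF0] at h1
      rw [sub_mul, ← h1]
      abel
    -- A zero of α would force F₁ = 0 through α = TF₁ with T ≠ 0, so F would vanish there and could
    -- not span a line.
    refine ⟨hμ, α, hα, fun p h0 => ?_, hdα, fun p => by rw [← hβ]; exact hTα p⟩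
    have h1 : F p 1 = 0 := by
      have := hTα p
      rw [h0] at this
      exact (mul_eq_zero.1 this.symm).resolve_left (hT p)
    have h2 : F p = 0 := by
      ext1 i
      fin_cases i
      · simp [hF0, h0, h1]
      · exact h1
    have h3 : psi fs p ∈ Submodule.span ℍ[ℝ]ᵐᵒᵖ {F p} := by
      rw [hspan]
      exact Submodule.mem_span_singleton_self _
    rw [h2, Submodule.span_zero_singleton, Submodule.mem_bot] at h3
    have := congrFun h3 1
    simp [psi] at this
  · rintro ⟨hμ, α, hα, hα0, hdα, hTα⟩
    have hβ := smooth_muDual (μ := μ) hf.gauss.smooth_N hα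
    have hβ0 : ∀ p, muDual N μ α p ≠ 0 := fun p h0 => hα0 p (by rw [hTα, h0, mul_zero])
    have hF : Smooth fun p => ![α p + f p * muDual N μ α p, muDual N μ α p] := by
      rw [smooth_pi]
      intro i
      fin_cases i
      · exact hα.add (hf.gauss.smooth_f.mul hβ)
      · exact hβ
    refine ⟨hμ, α, fun p => ![α p + f p * muDual N μ α p, muDual N μ α p], hα,
      ‹Nonempty M›.elim fun p => ⟨p, hα0 p⟩, fun p X => by rw [nablaMu_eq hf, hdα]; abel,
      ⟨hF, fun p => ?_, fun p X => ?_⟩, fun p => ?_⟩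
    · rw [mkQ_lineBundle_eq]
      simp
    · rw [mkQ_lineBundle_eq_zero, dif_pi hF, dif_pi hF]
      show dif (fun q => α q + f q * muDual N μ α q) p X = f p * dif (muDual N μ α) p X
      rw [dif_add (hα.mdifferentiableAt p) ((hf.gauss.smooth_f.mul hβ).mdifferentiableAt p),
        dif_mul (hf.gauss.smooth_f.mdifferentiableAt p) (hβ.mdifferentiableAt p), hdα]
      abel
    · have h1 : ![α p + f p * muDual N μ α p, muDual N μ α p] =
          MulOpposite.op (muDual N μ α p) • psi fs p := by
        ext1 i
        fin_cases i
        · simp only [Fin.zero_eta, Matrix.cons_val_zero, psi, Pi.smul_apply,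
            MulOpposite.smul_eq_mul_unop, MulOpposite.unop_op]
          nth_rw 1 [hTα]
          noncomm_ring
        · simp [psi]
      have hu : IsUnit (MulOpposite.op (muDual N μ α p)) :=
        IsUnit.mk0 _ (by simpa using hβ0 p)
      beta_reduce
      rw [h1, Submodule.span_singleton_smul_eq hu, lineBundle]

end Surface

/-! ### The spectral parameter μ and the numbers a and b. -/

section Parameters

theorem aOf_sq_add_bOf_sq {μ : ℂ} (hμ : μ ≠ 0) : aOf μ ^ 2 + bOf μ ^ 2 = 1 := by
  have h : bOf μ ^ 2 = -((μ⁻¹ - μ) / 2) ^ 2 := by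
    rw [bOf, mul_pow, Complex.I_sq]; ring
  rw [h, aOf]
  field_simp
  ring

theorem aOf_im (μ : ℂ) : (aOf μ).im = μ.im * (1 - (‖μ‖ ^ 2)⁻¹) / 2 := by
  have h : (aOf μ).im = (μ + μ⁻¹).im / 2 := by
    rw [aOf, show (2 : ℂ) = ((2 : ℝ) : ℂ) by norm_num, Complex.div_ofReal_im]
  rw [h, Complex.add_im, Complex.inv_im, Complex.normSq_eq_norm_sq]
  ring

theorem im_eq_zero_or_norm_eq_one {μ : ℂ} (h : (aOf μ).im = 0) :
    μ.im = 0 ∨ ‖μ‖ = 1 := by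
  rw [aOf_im, div_eq_zero_iff, mul_eq_zero] at h
  rcases h with (h | h) | h
  · exact Or.inl h
  · right
    have h1 : ‖μ‖ ^ 2 = 1 := by
      rw [← inv_inv (‖μ‖ ^ 2), ← sub_eq_zero.1 h, inv_one]
    exact (pow_eq_one_iff_of_nonneg (norm_nonneg _) two_ne_zero).1 h1
  · norm_num at h

theorem bOf_im_of_norm_eq_one {μ : ℂ} (h : ‖μ‖ = 1) : (bOf μ).im = 0 := by
  have h1 : μ⁻¹ = (starRingEnd ℂ) μ := Complex.inv_eq_conj h
  rw [bOf, h1, Complex.mul_I_im, show (2 : ℂ) = ((2 : ℝ) : ℂ) by norm_num, Complex.div_ofReal_re]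
  simp

theorem bOf_re_of_im_eq_zero {μ : ℂ} (h : μ.im = 0) : (bOf μ).re = 0 := by
  rw [bOf, Complex.mul_I_re, show (2 : ℂ) = ((2 : ℝ) : ℂ) by norm_num, Complex.div_ofReal_im]
  simp [h]

theorem eq_neg_one_of_aOf {μ : ℂ} (hμ : μ ≠ 0) (h : aOf μ = -1) : μ = -1 := by
  rw [aOf] at h
  field_simp at h
  have h1 : (μ + 1) ^ 2 = 0 := by linear_combination h
  exact eq_neg_of_add_eq_zero_left (pow_eq_zero_iff two_ne_zero |>.1 h1)

/-- Every point of the complex circle `a² + b² = 1` comes from a parameter `μ`. -/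
theorem exists_aOf_bOf {a b : ℂ} (h : a ^ 2 + b ^ 2 = 1) :
    ∃ μ : ℂ, μ ≠ 0 ∧ aOf μ = a ∧ bOf μ = b := by
  have h1 : (a + Complex.I * b) * (a - Complex.I * b) = 1 := by
    linear_combination h - b ^ 2 * Complex.I_sq
  have h0 : a + Complex.I * b ≠ 0 := left_ne_zero_of_mul_eq_one h1
  have h2 : (a + Complex.I * b)⁻¹ = a - Complex.I * b := inv_eq_of_mul_eq_one_right h1
  -- The definitions of a and b amount to μ = a + ib and μ⁻¹ = a - ib.
  refine ⟨a + Complex.I * b, h0, ?_, ?_⟩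
  · rw [aOf, h2]; ring
  · rw [bOf, h2]
    linear_combination -b * Complex.I_sq

end Parameters

/-! ### Quaternion identities. -/

section Quaternions

/-- With `T⁻¹ = U`: the two forms of the quadratic equation for a Darboux transform. -/
theorem sq_sub_eq_iff {T N : ℍ[ℝ]} (hT : T ≠ 0) (hN : N * N = -1) {r : ℝ} (hr : r ≠ 0) :
    (T - N) ^ 2 = ((r⁻¹ - 1 : ℝ) : ℍ[ℝ]) ↔
      (T⁻¹ + r • N) * (T⁻¹ + r • N) = ((r * (1 - r) : ℝ) : ℍ[ℝ]) := by
  have hU : T⁻¹ ≠ 0 := inv_ne_zero hT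
  have e1 : ∀ s : ℝ, (s : ℍ[ℝ]) = s • (1 : ℍ[ℝ]) := fun s => by
    rw [← Quaternion.coe_mul_eq_smul, mul_one]
  have e2 : (T - N) ^ 2 = ((r⁻¹ - 1 : ℝ) : ℍ[ℝ]) ↔ T * T - T * N - N * T = r⁻¹ • 1 := by
    rw [e1, pow_two, sub_mul, mul_sub, mul_sub, hN, sub_smul, one_smul, ← sub_eq_zero,
      ← sub_eq_zero (a := T * T - T * N - N * T)]
    refine Eq.congr ?_ rfl
    abel
  have e3 : (T⁻¹ + r • N) * (T⁻¹ + r • N) = ((r * (1 - r) : ℝ) : ℍ[ℝ]) ↔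
      r • (T⁻¹ * N + N * T⁻¹) + T⁻¹ * T⁻¹ = r • 1 := by
    have : (T⁻¹ + r • N) * (T⁻¹ + r • N) =
        r • (T⁻¹ * N + N * T⁻¹) + T⁻¹ * T⁻¹ - (r * r) • 1 := by
      simp only [add_mul, mul_add, smul_mul_assoc, mul_smul_comm, hN]
      module
    rw [e1, this, sub_eq_iff_eq_add, ← add_smul]
    refine Eq.congr rfl ?_
    congr 1
    ring
  -- Multiplying T² - TN - NT by T⁻¹ on both sides passes from the equation in T to the one in T⁻¹.
  have e4 : T⁻¹ * (T * T - T * N - N * T) * T⁻¹ = 1 - N * T⁻¹ - T⁻¹ * N := by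
    simp only [mul_sub, sub_mul]
    rw [inv_mul_cancel_left₀ hT, mul_inv_cancel₀ hT, inv_mul_cancel_left₀ hT, mul_assoc T⁻¹,
      mul_assoc N, mul_inv_cancel₀ hT, mul_one]
  rw [e2, e3]
  constructor
  · intro h
    rw [h, mul_smul_comm, smul_mul_assoc, mul_one] at e4
    have h1 : T⁻¹ * T⁻¹ = r • (1 - N * T⁻¹ - T⁻¹ * N) := by
      rw [← e4, smul_smul, mul_inv_cancel₀ hr, one_smul]
    rw [h1]
    module
  · intro h
    have h1 : T⁻¹ * (T * T - T * N - N * T) * T⁻¹ = T⁻¹ * (r⁻¹ • 1) * T⁻¹ := by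
      rw [e4, mul_smul_comm, smul_mul_assoc, mul_one, eq_sub_of_add_eq' h, smul_sub, smul_smul,
        smul_smul, inv_mul_cancel₀ hr]
      module
    exact mul_left_cancel₀ hU (mul_right_cancel₀ hU h1)

theorem re_conj_mul {x c : ℍ[ℝ]} (hx : x ≠ 0) : (x * c * x⁻¹).re = c.re := by
  have h : ∀ u v : ℍ[ℝ], (u * v).re = (v * u).re := fun u v => by
    simp only [Quaternion.re_mul]; ring
  rw [h, inv_mul_cancel_left₀ hx]

theorem re_inv_eq_zero {x : ℍ[ℝ]} (hx : x.re = 0) : x⁻¹.re = 0 := by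
  rw [Quaternion.inv_def]
  simp [hx]

end Quaternions

/-! ### Maps with vanishing differential. -/

section Constancy

variable {M : Type*} [TopologicalSpace M] [ChartedSpace ℂ M] [IsManifold 𝓘(ℂ, ℂ) ω M]

theorem exists_dif_ne_zero [PreconnectedSpace M] {h : M → ℍ[ℝ]} (hh : Smooth h)
    (hnc : ¬ ∃ c, ∀ p, h p = c) : ∃ p X, dif h p X ≠ 0 := by
  by_contra! h0
  have hloc : IsLocallyConstant h := (IsLocallyConstant.iff_eventually_eq h).2 fun p =>
    eventually_eq_of_dif_eq_zero (Filter.Eventually.of_forall fun q =>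
      ⟨hh.mdifferentiableAt q, h0 q⟩)
  rcases isEmpty_or_nonempty M with hM | ⟨⟨p⟩⟩
  · exact hnc ⟨0, fun p => hM.elim p⟩
  · exact hnc ⟨h p, fun q => hloc.apply_eq_of_preconnectedSpace q p⟩

theorem eventually_exists_dif_ne_zero {h : M → ℍ[ℝ]} (hh : Smooth h) {p : M} {X : ℂ}
    (hX : dif h p X ≠ 0) : ∀ᶠ q in 𝓝 p, ∃ Y, dif h q Y ≠ 0 := by
  have hps := mem_chart_source ℂ p
  have h1 : ContinuousAt (fderiv ℝ (h ∘ (chartAt ℂ p).symm)) (chartAt ℂ p p) :=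
    ((hh.contDiffOn_chart p).continuousOn_fderiv_of_isOpen (chartAt ℂ p).open_target
      (by simp)).continuousAt ((chartAt ℂ p).open_target.mem_nhds (mem_chart_target ℂ p))
  have h2 : fderiv ℝ (h ∘ (chartAt ℂ p).symm) (chartAt ℂ p p) X ≠ 0 := by
    rwa [← dif_eq_fderiv_chartAt (hh.mdifferentiableAt p)]
  have h3 : ContinuousAt (fun q => fderiv ℝ (h ∘ (chartAt ℂ p).symm) (chartAt ℂ p q) X) p :=
    (h1.comp ((chartAt ℂ p).continuousAt hps)).clm_apply continuousAt_const
  filter_upwards [h3.eventually_ne h2, (chartAt ℂ p).open_source.mem_nhds hps] with q hq hqs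
  rw [fderiv_chart_eq_dif hqs (hh.mdifferentiableAt q)] at hq
  exact ⟨_, hq⟩

end Constancy

/-! ### Derivative of a μ-Darboux transform. -/

section Forward

variable {M : Type*} [TopologicalSpace M] [ChartedSpace ℂ M] {f N : M → ℍ[ℝ]}

theorem coe_aOf_bOf_relation {μ : ℂ} (hμ : μ ≠ 0) :
    ((aOf μ - 1 : ℂ) : ℍ[ℝ]) * ((aOf μ - 1 : ℂ) : ℍ[ℝ]) +
      ((bOf μ : ℂ) : ℍ[ℝ]) * ((bOf μ : ℂ) : ℍ[ℝ]) = -((2 : ℝ) • ((aOf μ - 1 : ℂ) : ℍ[ℝ])) := by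
  have h : (aOf μ - 1) * (aOf μ - 1) + bOf μ * bOf μ = -(2 * (aOf μ - 1)) := by
    linear_combination aOf_sq_add_bOf_sq hμ
  have h2 := congrArg (fun z : ℂ => (z : ℍ[ℝ])) h
  simp only [Quaternion.coeComplex_add, Quaternion.coeComplex_mul] at h2
  rw [h2]
  ext <;> simp

/-- Since (a-1)² + b² = -2(a-1), applying to β the operation that produced it from α, with b
replaced by -b, returns a multiple of α. -/
theorem muDual_relation (hf : IsCMCSurface f N) {μ : ℂ} (hμ : μ ≠ 0) (α : M → ℍ[ℝ]) (p : M) :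
    N p * muDual N μ α p * ((aOf μ - 1 : ℂ) : ℍ[ℝ]) - muDual N μ α p * ((bOf μ : ℂ) : ℍ[ℝ]) =
      α p * ((aOf μ - 1 : ℂ) : ℍ[ℝ]) := by
  have h1 := coe_aOf_bOf_relation hμ
  have h2 : ((aOf μ - 1 : ℂ) : ℍ[ℝ]) * ((bOf μ : ℂ) : ℍ[ℝ]) =
      ((bOf μ : ℂ) : ℍ[ℝ]) * ((aOf μ - 1 : ℂ) : ℍ[ℝ]) := by
    rw [← Quaternion.coeComplex_mul, ← Quaternion.coeComplex_mul, mul_comm]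
  rw [muDual]
  generalize ((aOf μ - 1 : ℂ) : ℍ[ℝ]) = z at *
  generalize ((bOf μ : ℂ) : ℍ[ℝ]) = w at *
  have h3 : z * z = -((2 : ℝ) • z) - w * w := eq_sub_of_add_eq h1
  simp only [mul_add, add_mul, smul_mul_assoc, mul_smul_comm, mul_assoc, h2, h3,
    hf.normal_mul_normal_mul, mul_sub, mul_neg, neg_mul]
  module

/-- Substituting dα = -df β and moving N past df turns the terms with dα into ½ df α(a-1) by
`muDual_relation`. Together with ½ dN α(a-1) this produces dg. -/
theorem dif_muDual (hf : IsCMCSurface f N) {μ : ℂ} (hμ : μ ≠ 0) {α : M → ℍ[ℝ]} (hα : Smooth α)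
    (hd : ∀ p X, dif α p X = -(dif f p X * muDual N μ α p)) (p : M) (X : ℂ) :
    dif (muDual N μ α) p X = (1 / 2 : ℝ) •
      (dif (fun q => f q + N q) p X * α p * ((aOf μ - 1 : ℂ) : ℍ[ℝ])) := by
  have hN := hf.gauss.smooth_N
  have h1 : dif (muDual N μ α) p X = (1 / 2 : ℝ) •
      ((dif N p X * α p + N p * dif α p X) * ((aOf μ - 1 : ℂ) : ℍ[ℝ]) +
        dif α p X * ((bOf μ : ℂ) : ℍ[ℝ])) := by
    have e0 : muDual N μ α = fun p => (1 / 2 : ℝ) • (N p * α p * ((aOf μ - 1 : ℂ) : ℍ[ℝ]) +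
      α p * ((bOf μ : ℂ) : ℍ[ℝ])) := rfl
    rw [e0, dif_smul_const ((((hN.mul hα).mul (smooth_const _)).add
      (hα.mul (smooth_const _))).mdifferentiableAt p),
      dif_add (((hN.mul hα).mul (smooth_const _)).mdifferentiableAt p)
        ((hα.mul (smooth_const _)).mdifferentiableAt p),
      dif_mul ((hN.mul hα).mdifferentiableAt p) ((smooth_const _).mdifferentiableAt p),
      dif_mul (hN.mdifferentiableAt p) (hα.mdifferentiableAt p),
      dif_mul (hα.mdifferentiableAt p) ((smooth_const _).mdifferentiableAt p), dif_const,
      dif_const, mul_zero, add_zero, mul_zero, add_zero]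
  rw [h1, hd, hf.dif_parallel]
  congr 1
  have h2 := congrArg (fun x => dif f p X * x) (muDual_relation hf hμ α p)
  simp only [mul_sub] at h2
  have h3 : dif f p X * (N p * muDual N μ α p * ((aOf μ - 1 : ℂ) : ℍ[ℝ])) =
      -(N p * (dif f p X * muDual N μ α p) * ((aOf μ - 1 : ℂ) : ℍ[ℝ])) := by
    rw [← mul_assoc, ← mul_assoc, hf.dif_mul_normal]
    simp only [neg_mul, mul_assoc]
  rw [h3] at h2
  simp only [add_mul]
  rw [mul_assoc (dif f p X) (α p), ← h2]
  simp only [mul_neg, neg_mul, mul_assoc]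
  abel

variable {fs : M → ℍ[ℝ]} {μ : ℂ} {α : M → ℍ[ℝ]}

theorem IsMuSection.muDual_ne_zero (h : IsMuSection f N μ fs α) (p : M) :
    muDual N μ α p ≠ 0 := fun h0 => h.ne_zero p (by rw [h.eq_mul, h0, mul_zero])

theorem IsMuSection.inv_eq (h : IsMuSection f N μ fs α) (p : M) :
    (fs p - f p)⁻¹ = muDual N μ α p * (α p)⁻¹ := by
  refine inv_eq_of_mul_eq_one_right ?_
  rw [← mul_assoc, ← h.eq_mul, mul_inv_cancel₀ (h.ne_zero p)]

/-- Differentiating α = Tβ and using dα = -df β gives df♯ β = -T dβ, and β⁻¹ = α⁻¹T. -/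
theorem IsMuSection.dif_eq_sub (hf : IsCMCSurface f N) (hμ : μ ≠ 0) (hfs : Smooth fs)
    (h : IsMuSection f N μ fs α) (p : M) (X : ℂ) :
    dif fs p X = -((1 / 2 : ℝ) • ((fs p - f p) * dif (fun q => f q + N q) p X *
      (α p * ((aOf μ - 1 : ℂ) : ℍ[ℝ]) * (α p)⁻¹) * (fs p - f p))) := by
  have hT := hfs.sub hf.gauss.smooth_f
  have h1 : α = fun q => (fs q - f q) * muDual N μ α q := funext h.eq_mul
  have h2 := dif_mul (hT.mdifferentiableAt p)
    ((smooth_muDual (μ := μ) hf.gauss.smooth_N h.smooth).mdifferentiableAt p) X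
  rw [← h1, h.dif_eq, dif_sub (hfs.mdifferentiableAt p)
    (hf.gauss.smooth_f.mdifferentiableAt p), dif_muDual hf hμ h.smooth h.dif_eq] at h2
  have h3 : dif fs p X * muDual N μ α p = -((fs p - f p) * (1 / 2 : ℝ) •
      (dif (fun q => f q + N q) p X * α p * ((aOf μ - 1 : ℂ) : ℍ[ℝ]))) := by
    rw [sub_mul, ← sub_eq_zero] at h2
    rw [← sub_eq_zero, ← neg_eq_zero, ← h2]
    abel
  have h4 : fs p - f p = α p * (muDual N μ α p)⁻¹ := by
    rw [eq_mul_inv_iff_mul_eq₀ (h.muDual_ne_zero p)]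
    exact (h.eq_mul p).symm
  have h5 : dif fs p X = dif fs p X * muDual N μ α p * (muDual N μ α p)⁻¹ := by
    rw [mul_assoc, mul_inv_cancel₀ (h.muDual_ne_zero p), mul_one]
  rw [h5, h3]
  nth_rw 3 [h4]
  simp only [mul_smul_comm, smul_mul_assoc, neg_mul, mul_assoc]
  rw [inv_mul_cancel_left₀ (h.ne_zero p)]

/-- Where the parallel surface is immersed, the existence of an enveloping sphere congruence forces
the normal to commute with the spectral parameter. -/
theorem IsMuSection.commute (hf : IsCMCSurface f N) (hμ : μ ≠ 0)
    (hfs : IsClassicalDarboux f fs) (h : IsMuSection f N μ fs α) {p : M} {X : ℂ}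
    (hX : dif (fun q => f q + N q) p X ≠ 0) :
    N p * (α p * ((aOf μ - 1 : ℂ) : ℍ[ℝ]) * (α p)⁻¹) =
      α p * ((aOf μ - 1 : ℂ) : ℍ[ℝ]) * (α p)⁻¹ * N p := by
  have hT : fs p - f p ≠ 0 := sub_ne_zero.2 (hfs.ne p).symm
  have h1 := hfs.right_normal hf p X
  rw [h.dif_eq_sub hf hμ hfs.conformal.smooth, h.dif_eq_sub hf hμ hfs.conformal.smooth,
    hf.dif_parallel_I, ← hf.dif_parallel_mul_normal] at h1
  generalize α p * ((aOf μ - 1 : ℂ) : ℍ[ℝ]) * (α p)⁻¹ = c at *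
  generalize dif (fun q => f q + N q) p X = d at *
  generalize fs p - f p = T at *
  have h2 : (1 / 2 : ℝ) • (T * (d * (N p * c)) * T) = (1 / 2 : ℝ) • (T * (d * (c * N p)) * T) := by
    simp only [neg_mul, smul_mul_assoc, mul_assoc, mul_inv_cancel_left₀ hT, neg_inj] at h1
    simpa only [mul_assoc] using h1
  exact mul_left_cancel₀ hX (mul_left_cancel₀ hT (mul_right_cancel₀ hT
    (smul_right_injective _ (by norm_num : (1 / 2 : ℝ) ≠ 0) h2)))

end Forward

/-- The centralizer of a non-real complex number in ℍ is ℂ, where -1 has only the square roots i and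
-i. -/
theorem eq_I_or_eq_neg_I_of_commute {n : ℍ[ℝ]} (hn : n * n = -1) {z : ℂ} (hz : z.im ≠ 0)
    (h : n * (z : ℍ[ℝ]) = (z : ℍ[ℝ]) * n) :
    n = ((Complex.I : ℂ) : ℍ[ℝ]) ∨ n = ((-Complex.I : ℂ) : ℍ[ℝ]) := by
  have hJ := congrArg QuaternionAlgebra.imJ h
  have hK := congrArg QuaternionAlgebra.imK h
  have hR := congrArg QuaternionAlgebra.re hn
  have hI := congrArg QuaternionAlgebra.imI hn
  simp at hJ hK hR hI
  have h3 : n.imK = 0 := by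
    have : z.im * n.imK = 0 := by linarith
    exact (mul_eq_zero.1 this).resolve_left hz
  have h2 : n.imJ = 0 := by
    have : z.im * n.imJ = 0 := by linarith
    exact (mul_eq_zero.1 this).resolve_left hz
  rw [h2, h3] at hR hI
  have h0 : n.re = 0 := by
    have : n.re * n.imI = 0 := by linarith
    rcases mul_eq_zero.1 this with h | h
    · exact h
    · rw [h] at hR
      nlinarith [mul_self_nonneg n.re]
  rw [h0] at hR
  have h1 : (n.imI - 1) * (n.imI + 1) = 0 := by linarith
  rcases mul_eq_zero.1 h1 with h | h
  · left
    ext <;> simp [h0, h2, h3]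
    linarith
  · right
    ext <;> simp [h0, h2, h3]
    linarith

/-! ### Reality of a and the Riccati equation. -/

section Riccati

variable {M : Type*} [TopologicalSpace M] [ChartedSpace ℂ M] [IsManifold 𝓘(ℂ, ℂ) ω M]
  {f N fs : M → ℍ[ℝ]} {μ : ℂ} {α : M → ℍ[ℝ]}

/-- For non-real a the commutation relation puts α⁻¹Nα in the two-point set {i, -i}, and continuity
makes the choice locally constant. -/
theorem IsMuSection.eventually_normal_mul (hf : IsCMCSurface f N) (hμ : μ ≠ 0)
    (hfs : IsClassicalDarboux f fs) (h : IsMuSection f N μ fs α) (him : (aOf μ).im ≠ 0) {p : M}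
    {X : ℂ} (hX : dif (fun q => f q + N q) p X ≠ 0) :
    ∃ j : ℂ, j * j = -1 ∧ ∀ᶠ q in 𝓝 p, N q * α q = α q * (j : ℍ[ℝ]) := by
  have him' : (aOf μ - 1).im ≠ 0 := by simpa using him
  have hev : ∀ᶠ q in 𝓝 p, (α q)⁻¹ * N q * α q = ((Complex.I : ℂ) : ℍ[ℝ]) ∨
      (α q)⁻¹ * N q * α q = ((-Complex.I : ℂ) : ℍ[ℝ]) := by
    filter_upwards [eventually_exists_dif_ne_zero
      (hf.gauss.smooth_f.add hf.gauss.smooth_N) hX] with q ⟨Y, hY⟩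
    have h0 := h.ne_zero q
    refine eq_I_or_eq_neg_I_of_commute ?_ him' ?_
    · calc (α q)⁻¹ * N q * α q * ((α q)⁻¹ * N q * α q)
          = (α q)⁻¹ * (N q * N q) * α q := by
            simp only [mul_assoc, mul_inv_cancel_left₀ h0]
        _ = -1 := by rw [hf.normal_mul_self]; simp [h0]
    · have h1 := h.commute hf hμ hfs hY
      calc (α q)⁻¹ * N q * α q * ((aOf μ - 1 : ℂ) : ℍ[ℝ])
          = (α q)⁻¹ * (N q * (α q * ((aOf μ - 1 : ℂ) : ℍ[ℝ]) * (α q)⁻¹)) * α q := by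
            simp only [mul_assoc, inv_mul_cancel₀ h0, mul_one]
        _ = _ := by rw [h1]; simp only [mul_assoc, inv_mul_cancel_left₀ h0]
  have hcont : ContinuousAt (fun q => (α q)⁻¹ * N q * α q) p :=
    ((h.smooth.continuous.continuousAt.inv₀ (h.ne_zero p)).mul
      hf.gauss.smooth_N.continuous.continuousAt).mul h.smooth.continuous.continuousAt
  have hne : ((Complex.I : ℂ) : ℍ[ℝ]) ≠ ((-Complex.I : ℂ) : ℍ[ℝ]) := by
    intro h0
    have := congrArg QuaternionAlgebra.imI h0
    simp at this
    norm_num at this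
  have key : ∀ j : ℂ, (∀ᶠ q in 𝓝 p, (α q)⁻¹ * N q * α q = (j : ℍ[ℝ])) →
      ∀ᶠ q in 𝓝 p, N q * α q = α q * (j : ℍ[ℝ]) := fun j hj => by
    filter_upwards [hj] with q hq
    rw [← hq, mul_assoc, mul_inv_cancel_left₀ (h.ne_zero q)]
  rcases hev.self_of_nhds with hp | hp
  · refine ⟨Complex.I, Complex.I_mul_I, key _ ?_⟩
    filter_upwards [hev, hcont.eventually_ne (hp ▸ hne)] with q hq hq'
    exact hq.resolve_right hq'
  · refine ⟨-Complex.I, by simp, key _ ?_⟩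
    filter_upwards [hev, hcont.eventually_ne (hp ▸ hne.symm)] with q hq hq'
    exact hq.resolve_left hq'

/-- Suppose a is not real. Near a point with dg ≠ 0 one has Nα = αj, so also Nβ = βj.
Differentiating gives dN = -2 df βjα⁻¹, whence *dN = N dN. Against *dN = -N dN - 2N df this forces
dg = 0. -/
theorem IsMuSection.aOf_im_eq_zero [PreconnectedSpace M] (hf : IsCMCSurface f N) (hμ : μ ≠ 0)
    (hfs : IsClassicalDarboux f fs) (hnc : ¬ ∃ c, ∀ p, fs p = c)
    (h : IsMuSection f N μ fs α) : (aOf μ).im = 0 := by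
  by_contra him
  obtain ⟨p, X, hX⟩ := exists_dif_ne_zero hfs.conformal.smooth hnc
  have hg : dif (fun q => f q + N q) p X ≠ 0 := by
    intro h0
    rw [h.dif_eq_sub hf hμ hfs.conformal.smooth, h0] at hX
    simp at hX
  obtain ⟨j, hj, hev⟩ := h.eventually_normal_mul hf hμ hfs him hg
  have hN := hf.gauss.smooth_N
  have hα0 := h.ne_zero p
  have hj' : (j : ℍ[ℝ]) * (j : ℍ[ℝ]) = -1 := by
    rw [← Quaternion.coeComplex_mul, hj]; ext <;> simp
  have hNα := hev.self_of_nhds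
  set c : ℂ := (j * (aOf μ - 1) + bOf μ) with hc
  have hβ : muDual N μ α p = (1 / 2 : ℝ) • (α p * (c : ℍ[ℝ])) := by
    rw [muDual, hNα, hc, Quaternion.coeComplex_add, Quaternion.coeComplex_mul, mul_add, mul_assoc]
  have hNβ : N p * muDual N μ α p = muDual N μ α p * (j : ℍ[ℝ]) := by
    rw [hβ, mul_smul_comm, smul_mul_assoc, ← mul_assoc, hNα, mul_assoc, mul_assoc,
      ← Quaternion.coeComplex_mul, ← Quaternion.coeComplex_mul, mul_comm]
  have hdN : ∀ Y, dif N p Y = -(dif f p Y * ((2 : ℝ) • (muDual N μ α p * (j : ℍ[ℝ]) * (α p)⁻¹))) := by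
    intro Y
    have h1 := dif_congr hev Y
    rw [dif_mul (hN.mdifferentiableAt p) (h.smooth.mdifferentiableAt p),
      dif_mul (h.smooth.mdifferentiableAt p) ((smooth_const _).mdifferentiableAt p), dif_const,
      mul_zero, add_zero, h.dif_eq, mul_neg, ← mul_assoc (N p), ← neg_eq_iff_eq_neg.2
        (hf.dif_mul_normal p Y), neg_mul, neg_neg, mul_assoc, hNβ] at h1
    have h2 : dif N p Y * α p = -(dif f p Y * ((2 : ℝ) • (muDual N μ α p * (j : ℍ[ℝ])))) := by
      rw [eq_sub_of_add_eq h1, two_smul]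
      noncomm_ring
    have h3 : dif N p Y = dif N p Y * α p * (α p)⁻¹ := by
      rw [mul_assoc, mul_inv_cancel₀ hα0, mul_one]
    rw [h3, h2]
    simp only [neg_mul, mul_assoc, smul_mul_assoc]
  have h1 := hdN (Complex.I * X)
  rw [hf.dif_I, mul_assoc, ← mul_neg, ← hdN, hf.dif_normal_I] at h1
  have h2 : (-2 : ℝ) • (N p * (dif f p X + dif N p X)) = 0 := by
    rw [mul_add]
    rw [← sub_eq_zero] at h1
    rw [← h1]
    module
  rw [hf.dif_parallel] at hg
  have hN0 : N p ≠ 0 := fun h0 => by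
    have := hf.normal_mul_self p
    rw [h0] at this
    simp at this
  exact hg ((mul_eq_zero.1 ((smul_eq_zero.1 h2).resolve_left (by norm_num))).resolve_left hN0)

/-- A non-constant classical Darboux transform that is a `μ`-Darboux transform solves a Riccati
equation; the inverse of `T = fs - f` is determined by the parallel section. -/
theorem IsMuSection.exists_riccati [PreconnectedSpace M] (hf : IsCMCSurface f N) (hμ : μ ≠ 0)
    (hfs : IsClassicalDarboux f fs) (hnc : ¬ ∃ c, ∀ p, fs p = c)
    (h : IsMuSection f N μ fs α) :
    ∃ r : ℝ, r ≠ 0 ∧ aOf μ = ((1 - 2 * r : ℝ) : ℂ) ∧ SatisfiesRiccati f N fs r ∧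
      ∀ p, (fs p - f p)⁻¹ = -(r • N p) + (1 / 2 : ℝ) • (α p * ((bOf μ : ℂ) : ℍ[ℝ]) * (α p)⁻¹) := by
  have him := h.aOf_im_eq_zero hf hμ hfs hnc
  -- With a - 1 = -2r real, conjugation by α acts trivially on it and disappears from the formula
  -- for df♯.
  set r : ℝ := (1 - (aOf μ).re) / 2 with hr
  have ha : aOf μ = ((1 - 2 * r : ℝ) : ℂ) := by
    apply Complex.ext
    · simp [hr]
      ring
    · rw [him, Complex.ofReal_im]
  have hz : ((aOf μ - 1 : ℂ) : ℍ[ℝ]) = (-2 * r) • (1 : ℍ[ℝ]) := by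
    rw [ha]
    ext <;> simp
  have hzα : ∀ p, α p * ((aOf μ - 1 : ℂ) : ℍ[ℝ]) * (α p)⁻¹ = (-2 * r) • (1 : ℍ[ℝ]) := fun p => by
    rw [hz, mul_smul_comm, mul_one, smul_mul_assoc, mul_inv_cancel₀ (h.ne_zero p)]
  have hdfs : ∀ p X, dif fs p X =
      r • ((fs p - f p) * dif (fun q => f q + N q) p X * (fs p - f p)) := fun p X => by
    rw [h.dif_eq_sub hf hμ hfs.conformal.smooth, hzα, mul_smul_comm, mul_one, smul_mul_assoc]
    module
  have hr0 : r ≠ 0 := by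
    intro h0
    obtain ⟨p, X, hX⟩ := exists_dif_ne_zero hfs.conformal.smooth hnc
    rw [hdfs, h0, zero_smul] at hX
    exact hX rfl
  have hinv : ∀ p, (fs p - f p)⁻¹ =
      -(r • N p) + (1 / 2 : ℝ) • (α p * ((bOf μ : ℂ) : ℍ[ℝ]) * (α p)⁻¹) := fun p => by
    rw [h.inv_eq, muDual, hz, mul_smul_comm, mul_one, smul_mul_assoc, add_mul, smul_mul_assoc,
      mul_assoc (N p), mul_inv_cancel₀ (h.ne_zero p), mul_one]
    module
  refine ⟨r, hr0, ha, ⟨fun p X => ?_, fun p => ?_⟩, hinv⟩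
  · rw [dif_sub (hfs.conformal.smooth.mdifferentiableAt p)
      (hf.gauss.smooth_f.mdifferentiableAt p), hdfs]
  · rw [sq_sub_eq_iff (sub_ne_zero.2 (hfs.ne p).symm) (hf.normal_mul_self p) hr0, hinv]
    have hb : bOf μ * bOf μ = ((4 * (r * (1 - r)) : ℝ) : ℂ) := by
      have := aOf_sq_add_bOf_sq hμ
      rw [ha] at this
      push_cast at this ⊢
      linear_combination this
    have hb' : ((bOf μ : ℂ) : ℍ[ℝ]) * ((bOf μ : ℂ) : ℍ[ℝ]) = (4 * (r * (1 - r))) • (1 : ℍ[ℝ]) := by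
      rw [← Quaternion.coeComplex_mul, hb]
      ext <;> simp
    have h2 : ∀ x y : ℍ[ℝ], -x + y + x = y := fun x y => by abel
    rw [h2, smul_mul_smul_comm]
    have h3 : α p * ((bOf μ : ℂ) : ℍ[ℝ]) * (α p)⁻¹ * (α p * ((bOf μ : ℂ) : ℍ[ℝ]) * (α p)⁻¹) =
        (4 * (r * (1 - r))) • (1 : ℍ[ℝ]) := by
      calc _ = α p * (((bOf μ : ℂ) : ℍ[ℝ]) * ((bOf μ : ℂ) : ℍ[ℝ])) * (α p)⁻¹ := by
            simp only [mul_assoc, inv_mul_cancel_left₀ (h.ne_zero p)]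
        _ = _ := by
            rw [hb', mul_smul_comm, mul_one, smul_mul_assoc, mul_inv_cancel₀ (h.ne_zero p)]
    rw [h3, smul_smul]
    ext <;> simp; ring

end Riccati

theorem mul_self_eq_of_re_eq_zero {x : ℍ[ℝ]} (hx : x.re = 0) :
    x * x = (-Quaternion.normSq x) • (1 : ℍ[ℝ]) := by
  have h1 : star x = -x := Quaternion.star_eq_neg.2 hx
  have h2 := Quaternion.self_mul_star x
  rw [h1, mul_neg] at h2
  rw [← neg_eq_iff_eq_neg.2 h2.symm, neg_smul, ← Quaternion.coe_mul_eq_smul, mul_one]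

/-! ### Geometry of the transforms: translates of g, Gauss map, mean curvature. -/

section Types

variable {M : Type*} [TopologicalSpace M] [ChartedSpace ℂ M] {f N fs : M → ℍ[ℝ]} {r : ℝ}

theorem SatisfiesRiccati.dif_eq (h : SatisfiesRiccati f N fs r) (hf : Smooth f) (hfs : Smooth fs)
    (p : M) (X : ℂ) :
    dif fs p X = r • ((fs p - f p) * dif (fun q => f q + N q) p X * (fs p - f p)) := by
  have h1 := h.1 p X
  rw [dif_sub (hfs.mdifferentiableAt p) (hf.mdifferentiableAt p)] at h1
  exact sub_left_injective h1

/-- The spectral parameter on the unit circle gives translates of the parallel surface. -/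
theorem IsMuSection.eq_parallel_add_const {μ : ℂ} {α : M → ℍ[ℝ]} (hf : IsCMCSurface f N)
    (hμ : μ ≠ 0) (h : IsMuSection f N μ fs α) (hμ1 : ‖μ‖ = 1) (hr : r ≠ 0)
    (ha : aOf μ = ((1 - 2 * r : ℝ) : ℂ))
    (hinv : ∀ p, (fs p - f p)⁻¹ =
      -(r • N p) + (1 / 2 : ℝ) • (α p * ((bOf μ : ℂ) : ℍ[ℝ]) * (α p)⁻¹)) :
    ∃ c : ℝ, ∀ p, fs p = f p + N p + (c : ℍ[ℝ]) := by
  set b : ℝ := (bOf μ).re with hb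
  have hbμ : bOf μ = (b : ℂ) := by
    apply Complex.ext
    · rfl
    · rw [bOf_im_of_norm_eq_one hμ1, Complex.ofReal_im]
  have hb2 : b * b = 4 * (r * (1 - r)) := by
    have h1 := aOf_sq_add_bOf_sq hμ
    rw [ha, hbμ] at h1
    have h2 : (1 - 2 * r) ^ 2 + b ^ 2 = 1 := by exact_mod_cast h1
    linear_combination h2
  -- Here T⁻¹ = -rN + b/2 with b real, and b² = 4r(1-r) makes N + b/(2r) its inverse.
  refine ⟨b / 2 / r, fun p => ?_⟩
  have h1 : (fs p - f p)⁻¹ = -(r • N p) + (b / 2) • (1 : ℍ[ℝ]) := by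
    have : ((bOf μ : ℂ) : ℍ[ℝ]) = b • (1 : ℍ[ℝ]) := by
      rw [hbμ]; ext <;> simp
    rw [hinv, this, mul_smul_comm, mul_one, smul_mul_assoc, mul_inv_cancel₀ (h.ne_zero p),
      smul_smul]
    congr 2
    ring
  have h2 : (N p + (b / 2 / r) • (1 : ℍ[ℝ])) * (fs p - f p)⁻¹ = 1 := by
    have h3 : b / 2 / r * (b / 2) = 1 - r := by
      field_simp
      linear_combination hb2
    have h4 : b / 2 / r * r = b / 2 := by field_simp
    rw [h1]
    simp only [add_mul, mul_add, mul_neg, mul_smul_comm, smul_mul_assoc, mul_one, one_mul,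
      hf.normal_mul_self, smul_add, smul_neg, smul_smul]
    rw [mul_comm r, h4, mul_comm (b / 2), h3]
    module
  have h5 : fs p - f p = N p + (b / 2 / r) • (1 : ℍ[ℝ]) := by
    rw [eq_inv_of_mul_eq_one_left h2, inv_inv]
  rw [eq_add_of_sub_eq' h5, ← Quaternion.coe_mul_eq_smul, mul_one, add_assoc]

/-- For real μ the number b is purely imaginary, so N and αbα⁻¹ are both imaginary quaternions,
hence so are T⁻¹ and T. -/
theorem IsMuSection.re_sub_eq_zero {μ : ℂ} {α : M → ℍ[ℝ]} (hf : IsCMCSurface f N)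
    (h : IsMuSection f N μ fs α) (hμ : μ.im = 0)
    (hinv : ∀ p, (fs p - f p)⁻¹ =
      -(r • N p) + (1 / 2 : ℝ) • (α p * ((bOf μ : ℂ) : ℍ[ℝ]) * (α p)⁻¹)) (p : M) :
    (fs p - f p).re = 0 := by
  have h1 : ((fs p - f p)⁻¹).re = 0 := by
    rw [hinv]
    simp only [Quaternion.re_add, Quaternion.re_neg, Quaternion.re_smul, re_conj_mul (h.ne_zero p),
      hf.gauss.re_N]
    simp [bOf_re_of_im_eq_zero hμ]
  rw [← inv_inv (fs p - f p)]
  exact re_inv_eq_zero h1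

/-- The Gauss map of a Darboux transform in `ℝ³`. -/
def darbouxNormal (f N fs : M → ℍ[ℝ]) (p : M) : ℍ[ℝ] :=
  -((fs p - f p) * N p * (fs p - f p)⁻¹)

/-- From df♯ = rT dg T and the type of dg, the left normal is -TNT⁻¹ and the right-hand factor is
T⁻¹NT. They agree up to sign because T² is real for imaginary T. -/
theorem isGaussMap_darbouxNormal (hf : IsCMCSurface f N) (hfs : Smooth fs)
    (hne : ∀ p, f p ≠ fs p) (h : SatisfiesRiccati f N fs r) (hre : ∀ p, (fs p - f p).re = 0) :
    IsGaussMap fs (darbouxNormal f N fs) := by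
  have hT : ∀ p, fs p - f p ≠ 0 := fun p => sub_ne_zero.2 (hne p).symm
  have hTs := hfs.sub hf.gauss.smooth_f
  refine ⟨hfs, ((hTs.mul hf.gauss.smooth_N).mul (hTs.inv hT)).neg, fun p => ?_, fun p => ?_,
    fun p => ?_, fun p X => ?_, fun p X => ?_⟩
  · have := hre p
    rwa [Quaternion.re_sub, hf.gauss.re_f, sub_zero] at this
  · rw [darbouxNormal, Quaternion.re_neg, re_conj_mul (hT p), hf.gauss.re_N, neg_zero]
  · rw [darbouxNormal, neg_mul_neg]
    simp only [mul_assoc, inv_mul_cancel_left₀ (hT p), hf.normal_mul_normal_mul]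
    rw [mul_neg, mul_inv_cancel₀ (hT p)]
  · rw [hodge, h.dif_eq hf.gauss.smooth_f hfs, h.dif_eq hf.gauss.smooth_f hfs, hf.dif_parallel_I,
      darbouxNormal]
    simp only [mul_assoc, neg_mul, mul_neg, mul_smul_comm, inv_mul_cancel_left₀ (hT p), smul_neg]
  · have hTN : (fs p - f p) * ((fs p - f p) * (N p * (fs p - f p)⁻¹)) = N p * (fs p - f p) := by
      rw [← mul_assoc, mul_self_eq_of_re_eq_zero (hre p)]
      have h3 : (fs p - f p)⁻¹ = (-Quaternion.normSq (fs p - f p))⁻¹ • (fs p - f p) := by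
        refine inv_eq_of_mul_eq_one_right ?_
        rw [mul_smul_comm, mul_self_eq_of_re_eq_zero (hre p), smul_smul, inv_mul_cancel₀, one_smul]
        simpa using hne p ∘ fun h => (sub_eq_zero.1 h).symm
      rw [h3, mul_smul_comm, smul_mul_smul_comm, mul_inv_cancel₀, one_smul, one_mul]
      simpa using hne p ∘ fun h => (sub_eq_zero.1 h).symm
    rw [hodge, h.dif_eq hf.gauss.smooth_f hfs, h.dif_eq hf.gauss.smooth_f hfs, hf.dif_parallel_I,
      ← hf.dif_parallel_mul_normal, darbouxNormal]
    simp only [mul_assoc, mul_neg, smul_mul_assoc, neg_neg, hTN]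

/-- The quadratic equation rewrites N♯ as N - T + r⁻¹T⁻¹, and the Riccati equation then gives dN♯ =
-df♯ + r⁻¹T⁻¹df T⁻¹. The first summand is its own (1,0)-part with respect to N♯; the second has
none. -/
theorem hasMeanCurvature_darbouxNormal (hf : IsCMCSurface f N) (hfs : Smooth fs)
    (hne : ∀ p, f p ≠ fs p) (hr : r ≠ 0) (h : SatisfiesRiccati f N fs r)
    (hre : ∀ p, (fs p - f p).re = 0) :
    HasMeanCurvature fs (darbouxNormal f N fs) 1 := by
  have hT : ∀ p, fs p - f p ≠ 0 := fun p => sub_ne_zero.2 (hne p).symm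
  have hTs := hfs.sub hf.gauss.smooth_f
  have hG := isGaussMap_darbouxNormal hf hfs hne h hre
  have hN : darbouxNormal f N fs =
      fun p => (N p - (fs p - f p)) + r⁻¹ • (fs p - f p)⁻¹ := by
    ext1 p
    have h1 := h.2 p
    have h2 : (fs p - f p) * N p =
        (fs p - f p) * (fs p - f p) - N p * (fs p - f p) - r⁻¹ • 1 := by
      have e1 : (((r⁻¹ - 1 : ℝ)) : ℍ[ℝ]) = r⁻¹ • 1 - 1 := by
        rw [Quaternion.coe_sub, ← Quaternion.coe_mul_eq_smul, mul_one, Quaternion.coe_one]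
      rw [e1] at h1
      generalize fs p - f p = T at h1 ⊢
      rw [pow_two, sub_mul, mul_sub, mul_sub, hf.normal_mul_self, ← sub_eq_zero] at h1
      rw [← sub_eq_zero, ← neg_eq_zero, ← h1]
      abel
    rw [darbouxNormal, h2, sub_mul, sub_mul, mul_assoc, mul_inv_cancel₀ (hT p), mul_assoc,
      mul_inv_cancel₀ (hT p), mul_one, mul_one, smul_mul_assoc, one_mul]
    abel
  have hd : ∀ p X, dif (darbouxNormal f N fs) p X =
      -dif fs p X + r⁻¹ • ((fs p - f p)⁻¹ * dif f p X * (fs p - f p)⁻¹) := by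
    intro p X
    have hinv := mdifferentiableAt_inv (hTs.mdifferentiableAt p) (hT p)
    rw [hN, dif_add ((hf.gauss.smooth_N.sub hTs).mdifferentiableAt p)
      (((hTs.inv hT).const_smul _).mdifferentiableAt p),
      dif_sub (hf.gauss.smooth_N.mdifferentiableAt p) (hTs.mdifferentiableAt p),
      dif_smul_const hinv, dif_inv (hTs.mdifferentiableAt p) (hT p)]
    have h1 : (fs p - f p)⁻¹ * dif (fun q => fs q - f q) p X * (fs p - f p)⁻¹ =
        r • dif (fun q => f q + N q) p X -
          (fs p - f p)⁻¹ * dif f p X * (fs p - f p)⁻¹ := by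
      rw [h.1]
      have hTp := hT p
      generalize fs p - f p = T at hTp ⊢
      simp only [mul_sub, sub_mul, mul_smul_comm, smul_mul_assoc, mul_assoc,
        inv_mul_cancel_left₀ hTp, mul_inv_cancel₀ hTp, mul_one]
    rw [h1, dif_sub (hfs.mdifferentiableAt p) (hf.gauss.smooth_f.mdifferentiableAt p), neg_sub,
      smul_sub, smul_smul, inv_mul_cancel₀ hr, one_smul, hf.dif_parallel]
    abel
  intro p X
  rw [dNPrime, hodge, hd, hd, hf.dif_I, one_smul]
  have h1 : darbouxNormal f N fs p * dif fs p (Complex.I * X) = -dif fs p X := by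
    change darbouxNormal f N fs p * hodge (dif fs) p X = _
    rw [hG.left, ← mul_assoc, hG.sq_N, neg_one_mul]
  have h2 : darbouxNormal f N fs p *
      ((fs p - f p)⁻¹ * (N p * dif f p X) * (fs p - f p)⁻¹) =
      (fs p - f p)⁻¹ * dif f p X * (fs p - f p)⁻¹ := by
    have h3 : (fs p - f p)⁻¹ = (-Quaternion.normSq (fs p - f p))⁻¹ • (fs p - f p) := by
      refine inv_eq_of_mul_eq_one_right ?_
      rw [mul_smul_comm, mul_self_eq_of_re_eq_zero (hre p), smul_smul, inv_mul_cancel₀, one_smul]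
      simpa using hne p ∘ fun h => (sub_eq_zero.1 h).symm
    have h4 : (fs p - f p)⁻¹ * (fs p - f p)⁻¹ =
        (-Quaternion.normSq (fs p - f p))⁻¹ • (1 : ℍ[ℝ]) := by
      nth_rw 1 [h3]
      rw [smul_mul_assoc, mul_inv_cancel₀ (hT p)]
    have h5 : (fs p - f p) * N p * (fs p - f p)⁻¹ * (fs p - f p)⁻¹ * N p = -(fs p - f p)⁻¹ := by
      calc _ = (fs p - f p) * N p * ((fs p - f p)⁻¹ * (fs p - f p)⁻¹) * N p := by
            simp only [mul_assoc]
        _ = _ := by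
            rw [h4, mul_smul_comm, mul_one, smul_mul_assoc, mul_assoc, hf.normal_mul_self,
              mul_neg, mul_one, smul_neg, ← h3]
    rw [darbouxNormal, neg_mul]
    simp only [← mul_assoc]
    rw [h5]
    simp only [neg_mul, neg_neg]
  rw [mul_add, mul_neg, h1, mul_smul_comm, h2]
  module

end Types

/-! ### Algebra behind the Hopf differential. -/

section HopfAlgebra

theorem re_mul_comm (x y : ℍ[ℝ]) : (x * y).re = (y * x).re := by
  simp only [Quaternion.re_mul]; ring

theorem re_mul_eq_zero_of_anticomm {n a : ℍ[ℝ]} (h : a * n = -(n * a)) : (n * a).re = 0 := by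
  have h1 := re_mul_comm a n
  rw [h, Quaternion.re_neg] at h1
  linarith

variable {n a b A A₁ B C C₁ : ℍ[ℝ]}

/-- One of the two Cauchy–Riemann equations of `hopf`, pointwise: n is the normal, a and b are f_x
and g_x; A, A₁, B are f_xx, f_xy, f_yy, and C, C₁ are g_xx, g_xy. -/
theorem hopf_cauchyRiemann_re (hn : n * n = -1) (ha : a.re = 0) (hb : b.re = 0)
    (han : a * n = -(n * a)) (hbn : b * n = -(n * b)) (hA₁ : A₁ = (b - a) * a + n * A)
    (hC₁ : C₁ = -((b - a) * b) - n * C) (hB : B = (-(n * b) - n * a) * a + n * A₁) :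
    (B * b).re + (n * a * C₁).re = -(A * b).re - (a * C).re := by
  have haa := mul_self_eq_of_re_eq_zero ha
  have hbb := mul_self_eq_of_re_eq_zero hb
  have hnn : ∀ x, n * (n * x) = -x := fun x => by rw [← mul_assoc, hn, neg_one_mul]
  have han' : ∀ x, a * (n * x) = -(n * (a * x)) := fun x => by
    rw [← mul_assoc, han, neg_mul, mul_assoc]
  have h1 : B * b = (2 * Quaternion.normSq a) • (n * b) - A * b := by
    have : B = (2 * Quaternion.normSq a) • n - A := by
      rw [hB, hA₁]
      simp only [sub_mul, mul_add, mul_sub, neg_mul, mul_assoc, haa, hnn, mul_smul_comm, mul_one]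
      module
    rw [this, sub_mul, smul_mul_assoc]
  have h2 : n * a * C₁ = Quaternion.normSq b • (n * a) - Quaternion.normSq a • (n * b) - a * C := by
    rw [hC₁]
    have e1 : n * a * -((b - a) * b) = -(n * a * (b * b)) + n * (a * a) * b := by noncomm_ring
    rw [mul_sub, e1, haa, hbb]
    simp only [mul_assoc, han', mul_neg, hnn, mul_smul_comm, smul_mul_assoc, mul_one]
    module
  rw [h1, h2]
  simp only [Quaternion.re_sub, Quaternion.re_smul, re_mul_eq_zero_of_anticomm han,
    re_mul_eq_zero_of_anticomm hbn, smul_zero]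
  ring

theorem hopf_cauchyRiemann_im (ha : a.re = 0) (hb : b.re = 0) (han : a * n = -(n * a))
    (hC₁ : C₁ = -((b - a) * b) - n * C) : (a * C₁).re = (n * a * C).re := by
  have haa := mul_self_eq_of_re_eq_zero ha
  have hbb := mul_self_eq_of_re_eq_zero hb
  have h1 : a * C₁ = Quaternion.normSq b • a - Quaternion.normSq a • b + n * a * C := by
    have e1 : a * C₁ = -(a * (b * b)) + a * a * b - a * n * C := by rw [hC₁]; noncomm_ring
    rw [e1, haa, hbb, han]
    simp only [mul_smul_comm, smul_mul_assoc, mul_one, one_mul, neg_mul]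
    module
  rw [h1]
  simp [ha, hb]

/-- The product ab commutes with n, so it lies in the span of 1 and n; the two real parts are its
coordinates there up to sign. -/
theorem hopf_eq_zero (hnre : n.re = 0) (ha0 : a ≠ 0)
    (hn : n * n = -1) (han : a * n = -(n * a)) (hbn : b * n = -(n * b))
    (h1 : (a * b).re = 0) (h2 : (n * a * b).re = 0) : b = 0 := by
  have hcomm : a * b * n = n * (a * b) := by
    rw [mul_assoc, hbn, mul_neg, ← mul_assoc, han]
    simp only [neg_mul, neg_neg, mul_assoc]
  have h3 : star (n * (a * b)) = n * (a * b) := by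
    rw [StarMul.star_mul, Quaternion.star_eq_neg.2 h1, Quaternion.star_eq_neg.2 hnre, neg_mul_neg, hcomm]
  rw [Quaternion.star_eq_self, ← mul_assoc, h2, Quaternion.coe_zero] at h3
  have hn0 : n ≠ 0 := by
    rintro rfl
    simp at hn
  exact (mul_eq_zero.1 h3).resolve_left (mul_ne_zero hn0 ha0)

end HopfAlgebra

/-! ### The Hopf differential and isolated zeros of dg. -/

section Hopf

variable {M : Type*} [TopologicalSpace M] [ChartedSpace ℂ M] {f N : M → ℍ[ℝ]}

theorem dif_re {h : M → ℍ[ℝ]} (hh : Smooth h) (h0 : ∀ p, (h p).re = 0) (p : M) (X : ℂ) :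
    (dif h p X).re = 0 := by
  have h1 := mdifferentiableAt_iff_chart.1 (hh.mdifferentiableAt p)
  rw [dif_eq_fderiv_chartAt (hh.mdifferentiableAt p)]
  let L : ℍ[ℝ] →L[ℝ] ℝ := LinearMap.toContinuousLinearMap
    { toFun := fun x => x.re, map_add' := fun _ _ => rfl, map_smul' := fun _ _ => by simp }
  have h2 := L.hasFDerivAt.comp _ h1.2.hasFDerivAt
  have h3 : L ∘ h ∘ (chartAt ℂ p).symm = fun _ => 0 := funext fun z => h0 _
  rw [h3] at h2
  exact congrArg (fun f : ℂ →L[ℝ] ℝ => f X) (h2.unique (hasFDerivAt_const _ _))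

/-- The real part of a quaternion as a complex number. -/
def reComplex : ℍ[ℝ] →L[ℝ] ℂ := LinearMap.toContinuousLinearMap
  { toFun := fun x => (x.re : ℂ)
    map_add' := fun x y => by simp
    map_smul' := fun c x => by simp }

theorem reComplex_apply (x : ℍ[ℝ]) : reComplex x = (x.re : ℂ) := rfl

/-- The coefficient of the Hopf differential in the chart at `p`. -/
def hopf (f g : M → ℍ[ℝ]) (p : M) (z : ℂ) : ℂ :=
  Complex.I * reComplex (fderiv ℝ (f ∘ (chartAt ℂ p).symm) z Complex.I *
      fderiv ℝ (g ∘ (chartAt ℂ p).symm) z 1) -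
    reComplex (fderiv ℝ (f ∘ (chartAt ℂ p).symm) z 1 * fderiv ℝ (g ∘ (chartAt ℂ p).symm) z 1)

namespace IsCMCSurface

/-- Since dg(iX) = -N dg(X), the kernel of dg is a complex subspace of a complex line. -/
theorem dif_parallel_ne_zero (hf : IsCMCSurface f N) {p : M} {Y : ℂ}
    (hY : dif (fun q => f q + N q) p Y ≠ 0) {X : ℂ} (hX : X ≠ 0) :
    dif (fun q => f q + N q) p X ≠ 0 := by
  intro h0
  apply hY
  have h1 : Y = (Y / X).re • X + (Y / X).im • (Complex.I * X) := by
    calc Y = (Y / X) * X := by field_simp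
      _ = (((Y / X).re : ℂ) + (Y / X).im * Complex.I) * X := by rw [Complex.re_add_im]
      _ = _ := by simp only [Complex.real_smul]; ring
  have h2 : dif (fun q => f q + N q) p ((Y / X).re • X + (Y / X).im • (Complex.I * X)) =
      (Y / X).re • dif (fun q => f q + N q) p X +
        (Y / X).im • dif (fun q => f q + N q) p (Complex.I * X) :=
    ((mfderiv 𝓘(ℝ, ℂ) 𝓘(ℝ, ℍ[ℝ]) (fun q => f q + N q) p).map_add _ _).trans
      (congrArg₂ _ ((mfderiv 𝓘(ℝ, ℂ) 𝓘(ℝ, ℍ[ℝ]) (fun q => f q + N q) p).map_smul _ _)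
        ((mfderiv 𝓘(ℝ, ℂ) 𝓘(ℝ, ℍ[ℝ]) (fun q => f q + N q) p).map_smul _ _))
  rw [h1, h2, hf.dif_parallel_I, h0]
  simp

variable [IsManifold 𝓘(ℂ, ℂ) ω M]

theorem fderiv_chart (hf : IsCMCSurface f N) (p : M) {z : ℂ} (hz : z ∈ (chartAt ℂ p).target) :
    (∀ X, (fderiv ℝ (f ∘ (chartAt ℂ p).symm) z X).re = 0) ∧
    (∀ X, (fderiv ℝ ((fun q => f q + N q) ∘ (chartAt ℂ p).symm) z X).re = 0) ∧
    fderiv ℝ (f ∘ (chartAt ℂ p).symm) z Complex.I =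
      N ((chartAt ℂ p).symm z) * fderiv ℝ (f ∘ (chartAt ℂ p).symm) z 1 ∧
    fderiv ℝ ((fun q => f q + N q) ∘ (chartAt ℂ p).symm) z Complex.I =
      -(N ((chartAt ℂ p).symm z) * fderiv ℝ ((fun q => f q + N q) ∘ (chartAt ℂ p).symm) z 1) ∧
    fderiv ℝ (f ∘ (chartAt ℂ p).symm) z 1 * N ((chartAt ℂ p).symm z) =
      -(N ((chartAt ℂ p).symm z) * fderiv ℝ (f ∘ (chartAt ℂ p).symm) z 1) ∧
    fderiv ℝ ((fun q => f q + N q) ∘ (chartAt ℂ p).symm) z 1 * N ((chartAt ℂ p).symm z) =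
      -(N ((chartAt ℂ p).symm z) * fderiv ℝ ((fun q => f q + N q) ∘ (chartAt ℂ p).symm) z 1) ∧
    (∀ X, fderiv ℝ (N ∘ (chartAt ℂ p).symm) z X =
      fderiv ℝ ((fun q => f q + N q) ∘ (chartAt ℂ p).symm) z X -
        fderiv ℝ (f ∘ (chartAt ℂ p).symm) z X) ∧
    fderiv ℝ (f ∘ (chartAt ℂ p).symm) z 1 ≠ 0 := by
  have hq := (chartAt ℂ p).map_target hz
  have hg := hf.gauss.smooth_f.add hf.gauss.smooth_N
  have h1 := fun X => fderiv_chart_eq_dif hq (hf.gauss.smooth_f.mdifferentiableAt _) X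
  have h2 := fun X => fderiv_chart_eq_dif hq (hf.gauss.smooth_N.mdifferentiableAt _) X
  have h3 := fun X => fderiv_chart_eq_dif hq (hg.mdifferentiableAt _) X
  rw [(chartAt ℂ p).right_inv hz] at h1 h2 h3
  have hc := inv_ne_zero (chartDeriv_ne_zero hq)
  generalize (chartDeriv p ((chartAt ℂ p).symm z))⁻¹ = c at h1 h2 h3 hc
  refine ⟨fun X => ?_, fun X => ?_, ?_, ?_, ?_, ?_, fun X => ?_, ?_⟩
  · rw [h1]; exact dif_re hf.gauss.smooth_f hf.gauss.re_f _ _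
  · rw [h3]
    exact dif_re hg (fun p => by rw [Quaternion.re_add, hf.gauss.re_f, hf.gauss.re_N, add_zero]) _ _
  · rw [h1, h1, mul_one, mul_comm c, hf.dif_I]
  · rw [h3, h3, mul_one, mul_comm c, hf.dif_parallel_I]
  · rw [h1, hf.dif_mul_normal]
  · rw [h3, hf.dif_parallel_mul_normal]
  · rw [h1, h2, h3, hf.dif_parallel]
    abel
  · rw [h1, mul_one]
    exact hf.dif_ne_zero _ hc

/-- Differentiating f_y = Nf_x and g_y = -Ng_x with dN = dg - df expresses the required second
derivatives, and the two Cauchy–Riemann equations become the algebraic lemmas above. -/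
theorem differentiableAt_hopf (hf : IsCMCSurface f N) (p : M) {z : ℂ}
    (hz : z ∈ (chartAt ℂ p).target) :
    DifferentiableAt ℂ (hopf f (fun q => f q + N q) p) z := by
  have hopen := (chartAt ℂ p).open_target
  have hnhds := hopen.mem_nhds hz
  have hg := hf.gauss.smooth_f.add hf.gauss.smooth_N
  have hfd := fun w (hw : w ∈ (chartAt ℂ p).target) => hf.fderiv_chart p hw
  have hF := hf.gauss.smooth_f.contDiffOn_chart p
  have hG := hg.contDiffOn_chart p
  have hn : DifferentiableAt ℝ (N ∘ (chartAt ℂ p).symm) z :=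
    ((hf.gauss.smooth_N.contDiffOn_chart p).contDiffAt hnhds).differentiableAt (by simp)
  have hnz : (N ∘ (chartAt ℂ p).symm) z * (N ∘ (chartAt ℂ p).symm) z = -1 :=
    hf.normal_mul_self _
  simp only [← Function.comp_apply (f := N) (g := (chartAt ℂ p).symm)] at hfd
  unfold hopf
  generalize (N ∘ (chartAt ℂ p).symm) = n at *
  generalize (f ∘ (chartAt ℂ p).symm) = F at *
  generalize ((fun q => f q + N q) ∘ (chartAt ℂ p).symm) = G at *
  have hF2 : DifferentiableAt ℝ (fderiv ℝ F) z :=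
    ((hF.fderiv_of_isOpen hopen (m := ∞) (by simp)).contDiffAt hnhds).differentiableAt (by simp)
  have hG2 : DifferentiableAt ℝ (fderiv ℝ G) z :=
    ((hG.fderiv_of_isOpen hopen (m := ∞) (by simp)).contDiffAt hnhds).differentiableAt (by simp)
  have hFs : ∀ X Y, fderiv ℝ (fderiv ℝ F) z X Y = fderiv ℝ (fderiv ℝ F) z Y X := fun X Y =>
    ((hF.contDiffAt hnhds).isSymmSndFDerivAt (by simpa using two_le_infty)).eq X Y
  have hGs : ∀ X Y, fderiv ℝ (fderiv ℝ G) z X Y = fderiv ℝ (fderiv ℝ G) z Y X := fun X Y =>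
    ((hG.contDiffAt hnhds).isSymmSndFDerivAt (by simpa using two_le_infty)).eq X Y
  have hFX : ∀ X, HasFDerivAt (fun w => fderiv ℝ F w X) ((fderiv ℝ (fderiv ℝ F) z).flip X) z :=
    fun X => by simpa using hF2.hasFDerivAt.clm_apply (hasFDerivAt_const X z)
  have hGX : ∀ X, HasFDerivAt (fun w => fderiv ℝ G w X) ((fderiv ℝ (fderiv ℝ G) z).flip X) z :=
    fun X => by simpa using hG2.hasFDerivAt.clm_apply (hasFDerivAt_const X z)
  obtain ⟨hFre, hGre, hFI, hGI, hFn, hGn, hdn, -⟩ := hfd z hz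
  have e1 : ∀ Y, fderiv ℝ (fderiv ℝ F) z Y Complex.I =
      (fderiv ℝ G z Y - fderiv ℝ F z Y) * fderiv ℝ F z 1 +
        n z * fderiv ℝ (fderiv ℝ F) z Y 1 := by
    intro Y
    have h1 : (fun w => fderiv ℝ F w Complex.I) =ᶠ[𝓝 z] fun w => n w * fderiv ℝ F w 1 := by
      filter_upwards [hnhds] with w hw using (hfd w hw).2.2.1
    have h2 := (hFX Complex.I).unique ((hn.hasFDerivAt.mul' (hFX 1)).congr_of_eventuallyEq h1)
    have h3 := congrArg (fun L : ℂ →L[ℝ] ℍ[ℝ] => L Y) h2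
    rw [← hdn]
    simpa [add_comm] using h3
  have e2 : ∀ Y, fderiv ℝ (fderiv ℝ G) z Y Complex.I =
      -((fderiv ℝ G z Y - fderiv ℝ F z Y) * fderiv ℝ G z 1) -
        n z * fderiv ℝ (fderiv ℝ G) z Y 1 := by
    intro Y
    have h1 : (fun w => fderiv ℝ G w Complex.I) =ᶠ[𝓝 z] fun w => -(n w * fderiv ℝ G w 1) := by
      filter_upwards [hnhds] with w hw using (hfd w hw).2.2.2.1
    have h2 := (hGX Complex.I).unique
      ((hn.hasFDerivAt.mul' (hGX 1)).neg.congr_of_eventuallyEq h1)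
    have h3 := congrArg (fun L : ℂ →L[ℝ] ℍ[ℝ] => L Y) h2
    rw [← hdn, sub_eq_add_neg]
    simpa [add_comm] using h3
  have hR := reComplex.hasFDerivAt.comp z ((hFX Complex.I).mul' (hGX 1))
  have hP := reComplex.hasFDerivAt.comp z ((hFX 1).mul' (hGX 1))
  have hQ := (hR.const_mul Complex.I).sub hP
  refine differentiableAt_complex_iff_differentiableAt_real.2 ⟨hQ.differentiableAt, ?_⟩
  have c1 := hopf_cauchyRiemann_re hnz (hFre 1) (hGre 1) hFn hGn (e1 1) (e2 1)
    (B := fderiv ℝ (fderiv ℝ F) z Complex.I Complex.I) (by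
      rw [e1 Complex.I, hFI, hGI, hFs Complex.I 1])
  have c2 := hopf_cauchyRiemann_im (n := n z) (hFre 1) (hGre 1) hFn (e2 1)
  have hQ' : fderiv ℝ (fun w => Complex.I * reComplex (fderiv ℝ F w Complex.I * fderiv ℝ G w 1) -
      reComplex (fderiv ℝ F w 1 * fderiv ℝ G w 1)) z = _ := hQ.fderiv
  rw [hQ']
  simp only [sub_apply, smul_apply, ContinuousLinearMap.comp_apply, add_apply,
    ContinuousLinearMap.flip_apply, reComplex_apply, smul_eq_mul, MulOpposite.smul_eq_mul_unop,
    MulOpposite.unop_op, Quaternion.re_add, hFI, hFs Complex.I 1, hGs Complex.I 1]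
  rw [c2]
  have c1' : (n z * fderiv ℝ F z 1 * fderiv ℝ (fderiv ℝ G) z 1 Complex.I).re =
    -(fderiv ℝ (fderiv ℝ F) z 1 1 * fderiv ℝ G z 1).re -
      (fderiv ℝ F z 1 * fderiv ℝ (fderiv ℝ G) z 1 1).re -
      (fderiv ℝ (fderiv ℝ F) z Complex.I Complex.I * fderiv ℝ G z 1).re := by linarith
  rw [c1']
  push_cast
  linear_combination ((n z * fderiv ℝ F z 1 * fderiv ℝ (fderiv ℝ G) z 1 1).re +
    (fderiv ℝ (fderiv ℝ F) z 1 Complex.I * fderiv ℝ G z 1).re : ℂ) * (-Complex.I_sq)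

theorem fderiv_parallel_eq_zero_of_hopf (hf : IsCMCSurface f N) (p : M) {z : ℂ}
    (hz : z ∈ (chartAt ℂ p).target) (h : hopf f (fun q => f q + N q) p z = 0) :
    fderiv ℝ ((fun q => f q + N q) ∘ (chartAt ℂ p).symm) z 1 = 0 := by
  obtain ⟨-, -, hFI, -, hFn, hGn, -, h0⟩ := hf.fderiv_chart p hz
  have h1 := congrArg Complex.re h
  have h2 := congrArg Complex.im h
  simp only [hopf, reComplex_apply, Complex.sub_re, Complex.sub_im, Complex.mul_re, Complex.mul_im,
    Complex.I_re, Complex.I_im, Complex.ofReal_re, Complex.ofReal_im, Complex.zero_re,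
    Complex.zero_im] at h1 h2
  refine hopf_eq_zero (hf.gauss.re_N _) h0 (hf.normal_mul_self _) hFn hGn ?_ ?_
  · linarith
  · rw [← hFI]
    linarith

/-- The holomorphic function `hopf` vanishes exactly where dg does, so this is the dichotomy for
zeros of analytic functions. -/
theorem eventually_dif_parallel (hf : IsCMCSurface f N) (p : M) :
    (∀ᶠ q in 𝓝 p, dif (fun q => f q + N q) q 1 = 0) ∨
      ∀ᶠ q in 𝓝[≠] p, dif (fun q => f q + N q) q 1 ≠ 0 := by
  have hg := hf.gauss.smooth_f.add hf.gauss.smooth_N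
  have hps := mem_chart_source ℂ p
  have hcont := (chartAt ℂ p).continuousAt hps
  have han : AnalyticAt ℂ (hopf f (fun q => f q + N q) p) (chartAt ℂ p p) :=
    (DifferentiableOn.analyticOnNhd (fun z hz =>
      (hf.differentiableAt_hopf p hz).differentiableWithinAt) (chartAt ℂ p).open_target) _
      (mem_chart_target ℂ p)
  rcases han.eventually_eq_zero_or_eventually_ne_zero with h | h
  · left
    filter_upwards [hcont.eventually h, (chartAt ℂ p).open_source.mem_nhds hps] with q hq hqs
    have h1 := hf.fderiv_parallel_eq_zero_of_hopf p ((chartAt ℂ p).map_source hqs) hq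
    rw [fderiv_chart_eq_dif hqs (hg.mdifferentiableAt q)] at h1
    by_contra h2
    exact hf.dif_parallel_ne_zero h2
      (mul_ne_zero (inv_ne_zero (chartDeriv_ne_zero hqs)) one_ne_zero) h1
  · right
    have ht : Filter.Tendsto (chartAt ℂ p) (𝓝[≠] p) (𝓝[≠] (chartAt ℂ p p)) := by
      refine tendsto_nhdsWithin_of_tendsto_nhds_of_eventually_within _
        (hcont.mono_left nhdsWithin_le_nhds) ?_
      filter_upwards [nhdsWithin_le_nhds ((chartAt ℂ p).open_source.mem_nhds hps),
        self_mem_nhdsWithin] with q hqs hqp heq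
      exact hqp ((chartAt ℂ p).injOn hqs hps heq)
    filter_upwards [ht.eventually h,
      nhdsWithin_le_nhds ((chartAt ℂ p).open_source.mem_nhds hps)] with q hq hqs h0
    apply hq
    have h1 : fderiv ℝ ((fun q => f q + N q) ∘ (chartAt ℂ p).symm) (chartAt ℂ p q) 1 = 0 := by
      rw [fderiv_chart_eq_dif hqs (hg.mdifferentiableAt q)]
      by_contra h2
      exact hf.dif_parallel_ne_zero h2 one_ne_zero h0
    simp [hopf, h1]

/-- The points near which dg vanishes identically form a clopen set, which on a connected surface is
empty once dg ≠ 0 somewhere. -/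
theorem eventually_dif_parallel_ne_zero [PreconnectedSpace M] (hf : IsCMCSurface f N)
    {p₀ : M} {X : ℂ} (hX : dif (fun q => f q + N q) p₀ X ≠ 0) (p : M) :
    ∀ᶠ q in 𝓝[≠] p, dif (fun q => f q + N q) q 1 ≠ 0 := by
  let Z : Set M := {p | ∀ᶠ q in 𝓝 p, dif (fun q => f q + N q) q 1 = 0}
  have hopen : IsOpen Z := isOpen_iff_mem_nhds.2 fun p hp => eventually_eventually_nhds.2 hp
  have hclosed : IsClosed Z := by
    rw [← isOpen_compl_iff, isOpen_iff_mem_nhds]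
    intro p hp
    have h1 := (hf.eventually_dif_parallel p).resolve_left hp
    rw [eventually_nhdsWithin_iff] at h1
    filter_upwards [h1] with q hq hqZ
    rcases eq_or_ne q p with rfl | hne
    · exact hp hqZ
    · exact hq hne hqZ.self_of_nhds
  refine (hf.eventually_dif_parallel p).resolve_left fun hp => ?_
  have huniv : Z = Set.univ := IsClopen.eq_univ ⟨hclosed, hopen⟩ ⟨p, hp⟩
  have h0 : p₀ ∈ Z := huniv ▸ Set.mem_univ p₀
  exact hf.dif_parallel_ne_zero hX one_ne_zero 
    (show ∀ᶠ q in 𝓝 p₀, dif (fun q => f q + N q) q 1 = 0 from h0).self_of_nhds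

end IsCMCSurface

end Hopf

/-- A quaternion whose square is real is conjugate to a complex number. -/
theorem exists_conj_complex {B : ℍ[ℝ]} {s : ℝ} (hB : B * B = (s : ℍ[ℝ])) :
    ∃ β : ℂ, β * β = (s : ℂ) ∧ ∃ c : ℍ[ℝ], c ≠ 0 ∧ B * c = c * (β : ℍ[ℝ]) := by
  by_cases h0 : B.re = 0
  · set t : ℝ := Real.sqrt (Quaternion.normSq B) with ht
    have ht2 : t * t = Quaternion.normSq B := Real.mul_self_sqrt Quaternion.normSq_nonneg
    have hBB : B * B = (-(t * t)) • (1 : ℍ[ℝ]) := by rw [mul_self_eq_of_re_eq_zero h0, ht2]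
    have hs : s = -(t * t) := by
      rw [hB] at hBB
      have := congrArg QuaternionAlgebra.re hBB
      simpa using this
    have hI : ((Complex.I : ℂ) : ℍ[ℝ]) * ((Complex.I : ℂ) : ℍ[ℝ]) = -1 := by
      rw [← Quaternion.coeComplex_mul, Complex.I_mul_I]
      ext <;> simp
    have hcoe : ∀ x : ℝ, ((x * Complex.I : ℂ) : ℍ[ℝ]) = x • ((Complex.I : ℂ) : ℍ[ℝ]) := by
      intro x
      ext <;> simp
    -- For B² = -t² the element c = t - Bi satisfies Bc = c(ti). It is zero only if B = -ti, which
    -- is already complex.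
    by_cases hc : t • (1 : ℍ[ℝ]) - B * ((Complex.I : ℂ) : ℍ[ℝ]) = 0
    · refine ⟨((-t : ℝ) : ℂ) * Complex.I, ?_, 1, one_ne_zero, ?_⟩
      · rw [hs]
        push_cast
        linear_combination (t : ℂ) ^ 2 * Complex.I_sq
      · have h1 := congrArg (fun x => x * ((Complex.I : ℂ) : ℍ[ℝ])) hc
        simp only [sub_mul, smul_mul_assoc, one_mul, mul_assoc, hI, zero_mul, mul_neg, mul_one,
          sub_neg_eq_add] at h1
        rw [hcoe, one_mul, mul_one, neg_smul]
        exact eq_neg_of_add_eq_zero_right h1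
    · refine ⟨(t : ℂ) * Complex.I, ?_, _, hc, ?_⟩
      · rw [hs]
        push_cast
        linear_combination (t : ℂ) ^ 2 * Complex.I_sq
      · rw [hcoe, mul_sub, sub_mul, ← mul_assoc, hBB]
        simp only [mul_smul_comm, smul_mul_assoc, mul_assoc, hI, mul_one, one_mul, mul_neg]
        module
  -- If Re B ≠ 0, the imaginary part 2 Re(B) Im(B) of B² vanishes only for real B.
  · have hI := congrArg QuaternionAlgebra.imI hB
    have hJ := congrArg QuaternionAlgebra.imJ hB
    have hK := congrArg QuaternionAlgebra.imK hB
    have hR := congrArg QuaternionAlgebra.re hB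
    simp at hI hJ hK hR
    have h1 : B.imI = 0 := by
      have : B.re * B.imI = 0 := by linarith
      exact (mul_eq_zero.1 this).resolve_left h0
    have h2 : B.imJ = 0 := by
      have : B.re * B.imJ = 0 := by linarith
      exact (mul_eq_zero.1 this).resolve_left h0
    have h3 : B.imK = 0 := by
      have : B.re * B.imK = 0 := by linarith
      exact (mul_eq_zero.1 this).resolve_left h0
    refine ⟨(B.re : ℂ), ?_, 1, one_ne_zero, ?_⟩
    · rw [h1, h2, h3] at hR
      rw [← Complex.ofReal_mul]
      congr 1
      linarith
    · rw [mul_one, one_mul]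
      ext <;> simp [h1, h2, h3]

/-! ### From the Riccati equation back to a parallel section. -/

section Backward

variable {M : Type*} [TopologicalSpace M] [ChartedSpace ℂ M] {f N fs : M → ℍ[ℝ]} {r : ℝ}

theorem dif_eq_re_im (h : M → ℍ[ℝ]) (p : M) (X : ℂ) :
    dif h p X = X.re • dif h p 1 + X.im • dif h p (Complex.I * 1) := by
  have h1 : X = X.re • (1 : ℂ) + X.im • (Complex.I * 1) := by
    apply Complex.ext <;> simp
  have h2 : dif h p (X.re • (1 : ℂ) + X.im • (Complex.I * 1)) =
      X.re • dif h p 1 + X.im • dif h p (Complex.I * 1) :=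
    ((mfderiv 𝓘(ℝ, ℂ) 𝓘(ℝ, ℍ[ℝ]) h p).map_add _ _).trans
      (congrArg₂ _ ((mfderiv 𝓘(ℝ, ℂ) 𝓘(ℝ, ℍ[ℝ]) h p).map_smul _ _)
        ((mfderiv 𝓘(ℝ, ℂ) 𝓘(ℝ, ℍ[ℝ]) h p).map_smul _ _))
  rw [← h2, ← h1]

/-- The wedge product `df ∧ dg` vanishes by type. -/
theorem IsCMCSurface.dif_mul_dif_parallel_comm (hf : IsCMCSurface f N) (p : M) (X Y : ℂ) :
    dif f p X * dif (fun q => f q + N q) p Y = dif f p Y * dif (fun q => f q + N q) p X := by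
  rw [dif_eq_re_im f p X, dif_eq_re_im f p Y, dif_eq_re_im (fun q => f q + N q) p X,
    dif_eq_re_im (fun q => f q + N q) p Y, hf.dif_I, hf.dif_parallel_I]
  have h1 : ∀ x, dif f p 1 * (N p * x) = -(N p * (dif f p 1 * x)) := fun x => by
    rw [← mul_assoc, hf.dif_mul_normal, neg_mul, mul_assoc]
  simp only [add_mul, mul_add, smul_mul_assoc, mul_smul_comm, mul_neg, mul_assoc, h1,
    hf.normal_mul_normal_mul, smul_neg, neg_neg]
  module

theorem dif_inv_sub (hf : IsCMCSurface f N) (hfs : Smooth fs) (hne : ∀ p, f p ≠ fs p)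
    (h : SatisfiesRiccati f N fs r) (p : M) (X : ℂ) :
    dif (fun q => (fs q - f q)⁻¹) p X = (fs p - f p)⁻¹ * dif f p X * (fs p - f p)⁻¹ -
      r • dif (fun q => f q + N q) p X := by
  have hT : fs p - f p ≠ 0 := sub_ne_zero.2 (hne p).symm
  rw [dif_inv ((hfs.sub hf.gauss.smooth_f).mdifferentiableAt p) hT, h.1]
  generalize fs p - f p = T at hT ⊢
  simp only [mul_sub, sub_mul, mul_smul_comm, smul_mul_assoc, mul_assoc,
    inv_mul_cancel_left₀ hT, mul_inv_cancel₀ hT, mul_one]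
  abel

/-- For S = T⁻¹ the Riccati equation reads dS = S df S - r dg, and df ∧ dg = 0 by type. -/
theorem isIntegrablePair_inv_sub (hf : IsCMCSurface f N) (hfs : Smooth fs)
    (hne : ∀ p, f p ≠ fs p) (h : SatisfiesRiccati f N fs r) :
    IsIntegrablePair f (fun q => (fs q - f q)⁻¹) := by
  intro p X Y
  rw [dif_inv_sub hf hfs hne h, dif_inv_sub hf hfs hne h, mul_sub, mul_sub, mul_smul_comm,
    mul_smul_comm, hf.dif_mul_dif_parallel_comm p Y X]
  simp only [mul_assoc]
  abel

/-- With S = T⁻¹ and B = S + rN, the derivative is α⁻¹(df S B + dB - B df S)α. The bracket cancels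
by B² = r(1-r) and df N = -N df. -/
theorem dif_conj_eq_zero (hf : IsCMCSurface f N) (hfs : Smooth fs) (hne : ∀ p, f p ≠ fs p)
    (hr : r ≠ 0) (h : SatisfiesRiccati f N fs r) {α : M → ℍ[ℝ]} (hα : Smooth α)
    (hα0 : ∀ p, α p ≠ 0) (hd : ∀ p X, dif α p X = -(dif f p X * (fs p - f p)⁻¹ * α p))
    (p : M) (X : ℂ) :
    dif (fun q => (α q)⁻¹ * ((fs q - f q)⁻¹ + r • N q) * α q) p X = 0 := by
  have hT : ∀ p, fs p - f p ≠ 0 := fun p => sub_ne_zero.2 (hne p).symm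
  have hS := (hfs.sub hf.gauss.smooth_f).inv hT
  have hN := hf.gauss.smooth_N
  have hB := hS.add (hN.const_smul r)
  have hi := hα.inv hα0
  rw [dif_mul ((hi.mul hB).mdifferentiableAt p) (hα.mdifferentiableAt p),
    dif_mul (hi.mdifferentiableAt p) (hB.mdifferentiableAt p),
    dif_inv (hα.mdifferentiableAt p) (hα0 p), dif_add (hS.mdifferentiableAt p)
      ((hN.const_smul r).mdifferentiableAt p), dif_smul_const (hN.mdifferentiableAt p),
    dif_inv_sub hf hfs hne h, hd, hf.dif_parallel]
  have hsq := (sq_sub_eq_iff (hT p) (hf.normal_mul_self p) hr).1 (h.2 p)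
  have hα := hα0 p
  have hdN := hf.dif_mul_normal p X
  have hNN := hf.normal_mul_self p
  generalize (fs p - f p)⁻¹ = S at *
  have key : dif f p X * S * (S + r • N p) + (S * dif f p X * S - r • dif f p X) -
      (S + r • N p) * (dif f p X * S) = 0 := by
    have h1 : dif f p X * ((S + r • N p) * (S + r • N p)) = (r * (1 - r)) • dif f p X := by
      rw [hsq, Quaternion.mul_coe_eq_smul]
    have h2 : N p * dif f p X = -(dif f p X * N p) := by rw [hdN, neg_neg]
    simp only [add_mul, mul_add, smul_mul_assoc, mul_smul_comm, ← mul_assoc] at h1 ⊢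
    rw [mul_assoc _ (N p) (N p), hNN] at h1
    rw [h2]
    have h3 : dif f p X * S * S = (r * (1 - r)) • dif f p X - r • (dif f p X * S * N p) -
        r • (dif f p X * N p * S) + (r * r) • dif f p X := by
      rw [← h1]
      simp only [mul_neg, mul_one]
      module
    rw [h3]
    simp only [neg_mul]
    module
  have h4 : (α p)⁻¹ * (dif f p X * S * (S + r • N p) + (S * dif f p X * S - r • dif f p X) -
      (S + r • N p) * (dif f p X * S)) * α p = 0 := by rw [key, mul_zero, zero_mul]
  rw [← h4]
  simp only [mul_sub, sub_mul, mul_add, add_mul, mul_neg, neg_mul, neg_neg, mul_assoc,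
    mul_inv_cancel₀ hα, mul_smul_comm, smul_mul_assoc, smul_add, mul_one]
  module

variable [IsManifold 𝓘(ℂ, ℂ) ω M] [SimplyConnectedSpace M]

/-- A solution of dα = -df T⁻¹α is a μ-section as soon as β = T⁻¹α, that is (T⁻¹ + rN)α = αb/2. The
constancy of the conjugate reduces this to one point, where the initial value arranges it. -/
theorem SatisfiesRiccati.exists_isMuSection (hf : IsCMCSurface f N) (hfs : Smooth fs)
    (hne : ∀ p, f p ≠ fs p) (hr : r ≠ 0) (h : SatisfiesRiccati f N fs r) :
    ∃ μ : ℂ, μ ≠ 0 ∧ aOf μ = ((1 - 2 * r : ℝ) : ℂ) ∧ ∃ α, IsMuSection f N μ fs α := by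
  have hT : ∀ p, fs p - f p ≠ 0 := fun p => sub_ne_zero.2 (hne p).symm
  have hS := (hfs.sub hf.gauss.smooth_f).inv hT
  obtain ⟨p₀⟩ : Nonempty M := inferInstance
  obtain ⟨β, hβ, c, hc, hBc⟩ := exists_conj_complex
    ((sq_sub_eq_iff (hT p₀) (hf.normal_mul_self p₀) hr).1 (h.2 p₀))
  -- From β² = r(1-r) one gets (1-2r)² + (2β)² = 1.
  obtain ⟨μ, hμ, ha, hb⟩ := exists_aOf_bOf (a := ((1 - 2 * r : ℝ) : ℂ)) (b := 2 * β) (by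
    push_cast at hβ ⊢
    linear_combination 4 * hβ)
  obtain ⟨α, hα, hαp, hα0, hd⟩ := exists_parallel_section hf.gauss.smooth_f hS
    (isIntegrablePair_inv_sub hf hfs hne h) p₀ hc
  have hconst : ∀ p, (α p)⁻¹ * ((fs p - f p)⁻¹ + r • N p) * α p = (β : ℍ[ℝ]) := by
    have hsm := ((hα.inv hα0).mul (hS.add (hf.gauss.smooth_N.const_smul r))).mul hα
    have hex : ∃ k, ∀ p, (α p)⁻¹ * ((fs p - f p)⁻¹ + r • N p) * α p = k := by
      by_contra hnc
      obtain ⟨p, X, hX⟩ := exists_dif_ne_zero hsm hnc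
      exact hX (dif_conj_eq_zero hf hfs hne hr h hα hα0 hd p X)
    obtain ⟨k, hk⟩ := hex
    intro p
    rw [hk, ← hk p₀, hαp, mul_assoc, hBc, inv_mul_cancel_left₀ hc]
  have hdual : ∀ p, muDual N μ α p = (fs p - f p)⁻¹ * α p := by
    intro p
    have h1 : ((fs p - f p)⁻¹ + r • N p) * α p = α p * (β : ℍ[ℝ]) := by
      rw [← hconst p, mul_assoc (α p)⁻¹, mul_inv_cancel_left₀ (hα0 p)]
    have h2 : ((aOf μ - 1 : ℂ) : ℍ[ℝ]) = (-2 * r) • (1 : ℍ[ℝ]) := by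
      rw [ha]
      ext <;> simp
    have h3 : ((bOf μ : ℂ) : ℍ[ℝ]) = (2 : ℝ) • (β : ℍ[ℝ]) := by
      rw [hb]
      ext <;> simp
    rw [muDual, h2, h3, mul_smul_comm, mul_smul_comm, ← h1, mul_one, add_mul, smul_mul_assoc]
    module
  refine ⟨μ, hμ, ha, α, hα, hα0, fun p X => ?_, fun p => ?_⟩
  · rw [hdual, hd, mul_assoc]
  · rw [hdual, mul_inv_cancel_left₀ (hT p)]

end Backward

/-- A non-constant solution of the Riccati equations in `ℝ³` is a branched surface of constant mean
curvature. -/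
theorem SatisfiesRiccati.isBranchedCMCSurface {M : Type*} [TopologicalSpace M] [ChartedSpace ℂ M]
    [IsManifold 𝓘(ℂ, ℂ) ω M] [PreconnectedSpace M] {f N fs : M → ℍ[ℝ]} {r : ℝ}
    (hf : IsCMCSurface f N) (hfs : Smooth fs) (hne : ∀ p, f p ≠ fs p)
    (hnc : ¬ ∃ c, ∀ p, fs p = c) (hr : r ≠ 0) (h : SatisfiesRiccati f N fs r)
    (hre : ∀ p, (fs p - f p).re = 0) : IsBranchedCMCSurface fs := by
  refine ⟨⟨darbouxNormal f N fs, isGaussMap_darbouxNormal hf hfs hne h hre,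
    hasMeanCurvature_darbouxNormal hf hfs hne hr h hre⟩, fun p => ?_⟩
  have hT : ∀ p, fs p - f p ≠ 0 := fun p => sub_ne_zero.2 (hne p).symm
  obtain ⟨p₀, X, hX⟩ := exists_dif_ne_zero hfs hnc
  have hg : dif (fun q => f q + N q) p₀ X ≠ 0 := by
    intro h0
    rw [h.dif_eq hf.gauss.smooth_f hfs, h0] at hX
    simp at hX
  filter_upwards [hf.eventually_dif_parallel_ne_zero hg p] with q hq
  have key : ∀ Y : ℂ, dif fs q Y = 0 → Y = 0 := fun Y h1 => by
    by_contra hY0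
    rw [h.dif_eq hf.gauss.smooth_f hfs] at h1
    exact mul_ne_zero (mul_ne_zero (hT q) (hf.dif_parallel_ne_zero hq hY0)) (hT q)
      ((smul_eq_zero.1 h1).resolve_left hr)
  exact (injective_iff_map_eq_zero (mfderiv 𝓘(ℝ, ℂ) 𝓘(ℝ, ℍ[ℝ]) fs q)).2 fun Y hY => key Y hY

end DarbouxCMC

end

theorem mainTheorem9 {M : Type*} [TopologicalSpace M] [T2Space M] [SimplyConnectedSpace M]
    [ChartedSpace ℂ M] [IsManifold 𝓘(ℂ, ℂ) ω M]
    (f N : M → ℍ[ℝ]) (hf : DarbouxCMC.IsCMCSurface f N)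
    (fs : M → ℍ[ℝ]) (hfs : DarbouxCMC.IsClassicalDarboux f fs) (hnc : ¬ ∃ c, ∀ p, fs p = c) :
    ((∃ μ : ℂ, μ ≠ -1 ∧ DarbouxCMC.IsMuDarboux f N μ fs) ↔
      ∃ r : ℝ, r ≠ 0 ∧ r ≠ 1 ∧ DarbouxCMC.SatisfiesRiccati f N fs r) ∧
    (DarbouxCMC.IsMuDarboux f N (-1) fs ↔ DarbouxCMC.SatisfiesRiccati f N fs 1) ∧
    ∀ μ : ℂ, DarbouxCMC.IsMuDarboux f N μ fs →
      ((μ.im = 0 ∨ ‖μ‖ = 1) ∧ μ ≠ 1) ∧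
      (‖μ‖ = 1 → ∃ c : ℝ, ∀ p, fs p = f p + N p + (c : ℍ[ℝ])) ∧
      (μ.im = 0 → DarbouxCMC.IsBranchedCMCSurface fs) := by
  have hsm := hfs.conformal.smooth
  have hneg : ∀ r : ℝ, DarbouxCMC.aOf (-1) = ((1 - 2 * r : ℝ) : ℂ) → r = 1 := by
    intro r h
    have h1 : DarbouxCMC.aOf (-1) = ((-1 : ℝ) : ℂ) := by
      rw [DarbouxCMC.aOf]; norm_num
    rw [h1] at h
    have := Complex.ofReal_injective h
    linarith
  -- The value a = -1 is a double point of μ ↦ (μ + μ⁻¹)/2, so r = 1 determines μ = -1.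
  have hone : ∀ μ : ℂ, μ ≠ 0 → DarbouxCMC.aOf μ = ((1 - 2 * (1 : ℝ) : ℝ) : ℂ) → μ = -1 :=
    fun μ hμ h => DarbouxCMC.eq_neg_one_of_aOf hμ (by rw [h]; norm_num)
  refine ⟨⟨?_, ?_⟩, ⟨?_, ?_⟩, ?_⟩
  · rintro ⟨μ, hμ1, h⟩
    obtain ⟨hμ, α, hα⟩ := (DarbouxCMC.isMuDarboux_iff hf hfs.ne).1 h
    obtain ⟨r, hr, ha, hric, -⟩ := hα.exists_riccati hf hμ hfs hnc
    refine ⟨r, hr, ?_, hric⟩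
    rintro rfl
    exact hμ1 (hone μ hμ ha)
  · rintro ⟨r, hr, hr1, hric⟩
    obtain ⟨μ, hμ, ha, hα⟩ := hric.exists_isMuSection hf hsm hfs.ne hr
    refine ⟨μ, ?_, (DarbouxCMC.isMuDarboux_iff hf hfs.ne).2 ⟨hμ, hα⟩⟩
    rintro rfl
    exact hr1 (hneg r ha)
  · intro h
    obtain ⟨hμ, α, hα⟩ := (DarbouxCMC.isMuDarboux_iff hf hfs.ne).1 h
    obtain ⟨r, -, ha, hric, -⟩ := hα.exists_riccati hf hμ hfs hnc
    rwa [hneg r ha] at hric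
  · intro hric
    obtain ⟨μ, hμ, ha, hα⟩ := hric.exists_isMuSection hf hsm hfs.ne one_ne_zero
    rw [hone μ hμ ha] at hα
    exact (DarbouxCMC.isMuDarboux_iff hf hfs.ne).2 ⟨by norm_num, hα⟩
  · intro μ h
    obtain ⟨hμ, α, hα⟩ := (DarbouxCMC.isMuDarboux_iff hf hfs.ne).1 h
    obtain ⟨r, hr, ha, hric, hinv⟩ := hα.exists_riccati hf hμ hfs hnc
    refine ⟨⟨DarbouxCMC.im_eq_zero_or_norm_eq_one (by rw [ha, Complex.ofReal_im]), ?_⟩,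
      fun h1 => hα.eq_parallel_add_const hf hμ h1 hr ha hinv,
      fun h1 => hric.isBranchedCMCSurface hf hsm hfs.ne hnc hr (hα.re_sub_eq_zero hf h1 hinv)⟩
    rintro rfl
    have h1 : DarbouxCMC.aOf 1 = ((1 : ℝ) : ℂ) := by rw [DarbouxCMC.aOf]; norm_num
    rw [h1] at ha
    have := Complex.ofReal_injective ha
    exact hr (by linarith)
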